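/- An affine semigroup is a finitely generated submonoid $S$ of $\mathbb{N}^d$. Its embedding dimension is the number $n$ of elements of its unique minimal generating set $\{a_1,\dots,a_n\}$. Let $\mathrm{cone}(S)$ be the set of nonnegative rational combinations of elements of $S$, and let $\mathrm{PF}(S)$ be the set of all $f\in(\mathrm{cone}(S)\setminus S)\cap\mathbb{N}^d$ such that $f+s\in S$ for all $s\in S\setminus\{0\}$. The Betti-type of $S$ is $|\mathrm{PF}(S)|$. For a field $k$, view the semigroup ring $k[S]$ as a module over $R=k[x_1,\dots,x_n]$ via $x_i\mapsto \mathbf{t}^{a_i}$; $S$ is an MPD-semigroup if $\mathrm{pdim}_R\,k[S]=n-1$ (below, this holds over every field $k$). Let $G(S)\subseteq\mathbb{Z}^d$ be the group spanned by $S$. If the minimal generating set of $S$ is a disjoint union of nonempty sets $A_1,A_2$, and $S_i=\langle A_i\rangle$, then $S$ is the gluing of $S_1$ and $S_2$ by $g$ if $g\in S_1\cap S_2$ and $G(S_1)\cap G(S_2)=g\mathbb{Z}$. For every $e\ge 4$ there are MPD-semigroups in $\mathbb{N}^2$ of embedding dimension $e$ with arbitrarily large finite Betti-type. More precisely, let $a\ge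 3$ be odd and $p\ge 1$, and put $$S_{a,p}=\langle (a,0),(0,a^p),(a+2,2),(2,2+a^p)\rangle .$$ 1. ($e=4$.) $S_{a,p}$ is an MPD-semigroup of embedding dimension $4$, and its Betti-type is finite and at least $a^p-1$. 2. ($e=5$.) Let $m\ge 2$, and assume $p\ge 2$ or $\gcd(a,m)=1$. Then the semigroup generated by $m\,S_{a,p}$ and $(a,a^p)$ is the gluing of $m\,S_{a,p}$ and $\mathbb{N}(a,a^p)$ by $m(a,a^p)$; it is an MPD-semigroup of embedding dimension $5$, and its Betti-type is finite and at least $a^p-1$. 3. ($e=s+4\ge 6$.) Let $S_1$ be a numerical semigroup (a submonoid of $\mathbb{N}$ with finite complement) with minimal generators $n_1,\dots,n_s$, $s\ge 2$. Let $\mu=n_1+\dots+n_s$, and let $\nu$ be the number of pseudo-Frobenius numbers of $S_1$, that is, of $f\in\mathbb{N}\setminus S_1$ with $f+t\in S_1$ for all $t\in S_1\setminus\{0\}$. Assume $p\ge 2$ or $\gcd(a,\mu)=1$. Then $$S_{a,p,s}=\langle \mu(a,0),\mu(0,a^p),\mu(a+2,2),\mu(2,2+a^p),n_1(a,a^p),\dots,n_s(a,a^p)\rangle$$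 is the gluing of $\mu\,S_{a,p}$ and $\langle n_1(a,a^p),\dots,n_s(a,a^p)\rangle$ by $\mu(a,a^p)$; it is an MPD-semigroup of embedding dimension $s+4$, and its Betti-type is finite and at least $\nu(a^p-1)$. -/

import Mathlib

universe u

noncomputable section

namespace AffineSemigroup

/-- The minimal system of generators (Hilbert basis) of a submonoid `S` of `ℕ^d` or of `ℕ`: the
nonzero elements of `S` that are not a sum of two nonzero elements of `S`. -/
def minGens {M : Type*} [AddCommMonoid M] (S : AddSubmonoid M) : Set M :=
  {a | a ∈ S ∧ a ≠ 0 ∧ ∀ b ∈ S, ∀ c ∈ S, a = b + c → b = 0 ∨ c = 0}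

/-- The embedding dimension: the number of minimal generators (used for finitely generated `S`). -/
def embDim {M : Type*} [AddCommMonoid M] (S : AddSubmonoid M) : ℕ :=
  (minGens S).ncard

/-- The rational cone of `S`: all nonnegative rational combinations of elements of `S`. -/
def cone {d : ℕ} (S : AddSubmonoid (Fin d → ℕ)) : Submodule ℚ≥0 (Fin d → ℚ) :=
  Submodule.span ℚ≥0 ((fun (a : Fin d → ℕ) (i : Fin d) => (a i : ℚ)) '' (S : Set (Fin d → ℕ)))

/-- The gaps `H(S) = (cone(S) \ S) ∩ ℕ^d`. -/
def gaps {d : ℕ} (S : AddSubmonoid (Fin d → ℕ)) : Set (Fin d → ℕ) :=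
  {f | (fun i => (f i : ℚ)) ∈ cone S ∧ f ∉ S}

/-- The set `PF(S)` of pseudo-Frobenius elements. -/
def PF {d : ℕ} (S : AddSubmonoid (Fin d → ℕ)) : Set (Fin d → ℕ) :=
  {f | f ∈ gaps S ∧ ∀ s ∈ S, s ≠ 0 → f + s ∈ S}

/-- The Betti-type: the number of pseudo-Frobenius elements (used together with finiteness). -/
def bettiType {d : ℕ} (S : AddSubmonoid (Fin d → ℕ)) : ℕ :=
  (PF S).ncard

/-- The presentation `k[x_a : a a minimal generator of S] → k[S]`, `x_a ↦ t^a`, of the semigroup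
ring `k[S]`. -/
def presentation (k : Type*) [Field k] {d : ℕ} (S : AddSubmonoid (Fin d → ℕ)) :
    MvPolynomial (minGens S) k →ₐ[k] AddMonoidAlgebra k S :=
  MvPolynomial.aeval fun a => AddMonoidAlgebra.single (⟨a.1, a.2.1⟩ : S) (1 : k)

/-- `k[S]` as a module over the polynomial ring `R = k[x_a : a a minimal generator of S]`. -/
def semigroupModule (k : Type*) [Field k] {d : ℕ} (S : AddSubmonoid (Fin d → ℕ)) :
    ModuleCat (MvPolynomial (minGens S) k) :=
  (ModuleCat.restrictScalars (presentation k S).toRingHom).obj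
    (ModuleCat.of (AddMonoidAlgebra k S) (AddMonoidAlgebra k S))

/-- `S` is an affine semigroup of maximal projective dimension over `k`: it is finitely generated
and `pdim_R k[S] = n - 1`, where `n` is the number of minimal generators of `S`. -/
def IsMPD (k : Type*) [Field k] {d : ℕ} (S : AddSubmonoid (Fin d → ℕ)) : Prop :=
  S.FG ∧ CategoryTheory.projectiveDimension (semigroupModule k S) + 1 = (embDim S : WithBot ℕ∞)

/-- The subgroup `G(S)` of `ℤ^d` spanned by `S`. -/
def groupOf {d : ℕ} (S : AddSubmonoid (Fin d → ℕ)) : AddSubgroup (Fin d → ℤ) :=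
  AddSubgroup.closure ((fun (a : Fin d → ℕ) (i : Fin d) => (a i : ℤ)) '' (S : Set (Fin d → ℕ)))

/-- `S` is the gluing of `S₁` and `S₂` by `s`. -/
def IsGluing {d : ℕ} (S S₁ S₂ : AddSubmonoid (Fin d → ℕ)) (s : Fin d → ℕ) : Prop :=
  S.FG ∧
  (∃ A₁ A₂ : Set (Fin d → ℕ), A₁.Nonempty ∧ A₂.Nonempty ∧ Disjoint A₁ A₂ ∧
    A₁ ∪ A₂ = minGens S ∧ AddSubmonoid.closure A₁ = S₁ ∧ AddSubmonoid.closure A₂ = S₂) ∧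
  s ∈ S₁ ∧ s ∈ S₂ ∧
  groupOf S₁ ⊓ groupOf S₂ = AddSubgroup.zmultiples (fun i => (s i : ℤ))

/-- `n₁, …, n_s` are (without repetition) the minimal generators of a numerical semigroup, that is,
of a submonoid of `ℕ` with finite complement. -/
def IsNumericalGenerators {s : ℕ} (n : Fin s → ℕ) : Prop :=
  Function.Injective n ∧
  minGens (AddSubmonoid.closure (Set.range n)) = Set.range n ∧
  {x : ℕ | x ∉ AddSubmonoid.closure (Set.range n)}.Finite

/-- The pseudo-Frobenius numbers of a numerical semigroup. -/
def numericalPF (T : AddSubmonoid ℕ) : Set ℕ :=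
  {f | f ∉ T ∧ ∀ t ∈ T, t ≠ 0 → f + t ∈ T}

/-- The four generators of `S_{a,p}`. -/
def sapGens (a p : ℕ) : Set (Fin 2 → ℕ) :=
  {![a, 0], ![0, a ^ p], ![a + 2, 2], ![2, 2 + a ^ p]}

/-- `S_{a,p} = ⟨(a,0), (0,a^p), (a+2,2), (2,2+a^p)⟩`. -/
def sap (a p : ℕ) : AddSubmonoid (Fin 2 → ℕ) :=
  AddSubmonoid.closure (sapGens a p)

/-- The generators of `S_{a,p}`, scaled by `m`. -/
def scaledSapGens (a p m : ℕ) : Set (Fin 2 → ℕ) :=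
  (fun v => m • v) '' sapGens a p

/-- The vectors `n_i (a, a^p)`. -/
def scaledNumGens (a p : ℕ) {s : ℕ} (n : Fin s → ℕ) : Set (Fin 2 → ℕ) :=
  Set.range fun i => n i • ![a, a ^ p]

/-- The semigroup generated by the vectors `m v`, `v` a generator of `S_{a,p}`, and the vectors
`n_i (a, a^p)`. -/
def glued (a p m : ℕ) {s : ℕ} (n : Fin s → ℕ) : AddSubmonoid (Fin 2 → ℕ) :=
  AddSubmonoid.closure (scaledSapGens a p m ∪ scaledNumGens a p n)

/-- `glued a p m n` is the gluing of the scaled `S_{a,p}` and the scaled numerical semigroup by the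
element `m (a, a^p)`. -/
def IsSapGluing (a p m : ℕ) {s : ℕ} (n : Fin s → ℕ) : Prop :=
  IsGluing (glued a p m n) (AddSubmonoid.closure (scaledSapGens a p m))
    (AddSubmonoid.closure (scaledNumGens a p n)) (m • ![a, a ^ p])

end AffineSemigroup

end

/-! The link between combinatorics and homology is `isMPD_of_PF_nonempty`. For `f ∈ PF(S)`,
adjoining `t ^ f` to `k[S]` inside `k[ℕ ^ d]` gives a module `N` and an exact sequence `0 → k[S] → N
→ K → 0`, where `K` is the residue field of `R` at the origin. Both `k[S]` and `N` are free over
`k[x]` for any single variable `x`, because `x` shifts their monomial bases injectively and raises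
degree. Each of the other `n - 1` variables costs at most one in projective dimension, so both have
dimension at most `n - 1` (`MvPolynomial.hasProjectiveDimensionLT_card_of_basis`). But `Ext^n(K, K)
≠ 0`, so `pdim K` is not below `n`, and `pdim k[S] < n - 1` would contradict the sequence.
Finiteness of `PF(S)` is Dickson's lemma (`finite_PF`).

It remains to exhibit pseudo-Frobenius elements. Put `q = a ^ p` and `δ = (a, q)`. By `mem_sap_iff`,
`S_{a,p}` consists of the vectors `(2N + aα, 2N + qβ)` with `N ≤ α + β`. The elements `sapPF` have
`N = q - 1` and `α + β = q - 2`, so they miss the inequality by one. Since `q` is odd, any other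
representation has larger `N` and smaller `α + β`, so none repairs the defect; adding any nonzero
element of `S_{a,p}` does.

For the gluings, let `T` be the numerical semigroup generated by the `n i`. Elements have the form
`m v + t δ` with `v ∈ S_{a,p}`, `t ∈ T`, and two such expressions differ only by moving a multiple
of `m δ` from one summand to the other (`exchange`, resting on `dvd_of_mul_eq`). This yields the
minimal generators and the group intersection. It also shows that `m f + (m + φ) δ` is
pseudo-Frobenius for `f` one of the `sapPF` and `φ` a pseudo-Frobenius number of `T`, with `φ = -1`
when `T = ℕ` (`add_mem_PF_glued`). Distinct pairs give distinct elements, hence the product bound.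
-/

section ProjectiveDimension

open CategoryTheory Abelian Polynomial TensorProduct

/-! ### Upper bounds for projective dimension over polynomial rings -/

namespace ModuleCat

/-- Flat base change does not increase the projective dimension. -/
lemma hasProjectiveDimensionLE_baseChange {A B : Type u} [CommRing A] [CommRing B] [Algebra A B]
    [Module.Flat A B] (n : ℕ) (M : Type u) [AddCommGroup M] [Module A M]
    (h : HasProjectiveDimensionLE (ModuleCat.of A M) n) :
    HasProjectiveDimensionLE (ModuleCat.of B (B ⊗[A] M)) n := by
  induction n generalizing M with
  | zero =>
    simp only [HasProjectiveDimensionLE, zero_add] at h ⊢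
    rw [← projective_iff_hasProjectiveDimensionLT_one, ← IsProjective.iff_projective] at h ⊢
    infer_instance
  | succ n ih =>
    -- Dimension shifting: the kernel of a free cover has bound `n`, and by flatness the covering
    -- sequence stays exact over `B`.
    obtain ⟨P, _, _, _, f, hf⟩ : ∃ (P : Type u) (_ : AddCommGroup P) (_ : Module A P)
        (_ : Module.Projective A P) (f : P →ₗ[A] M), Function.Surjective f :=
      ⟨M →₀ A, inferInstance, inferInstance, inferInstance, Finsupp.linearCombination A id,
        Finsupp.linearCombination_id_surjective A M⟩
    have hS := LinearMap.shortExact_shortComplexKer hf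
    have hK := (hS.hasProjectiveDimensionLT_X₃_iff n
      ((IsProjective.iff_projective _).mp (inferInstanceAs (Module.Projective A P)))).mp h
    have hex : Function.Exact ((LinearMap.ker f).subtype.baseChange B) (f.baseChange B) :=
      lTensor_exact B (LinearMap.exact_subtype_ker_map f) hf
    have hT : (ModuleCat.shortComplexOfCompEqZero _ _ hex.linearMap_comp_eq_zero).ShortExact :=
      ModuleCat.shortComplex_shortExact _ hex
        (Module.Flat.lTensor_preserves_injective_linearMap _ (LinearMap.ker f).injective_subtype)
        (LinearMap.lTensor_surjective B hf)
    exact (hT.hasProjectiveDimensionLT_X₃_iff n ((IsProjective.iff_projective _).mp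
      (inferInstanceAs (Module.Projective B (B ⊗[A] P))))).mpr (ih _ hK)

end ModuleCat

namespace PolynomialModule

variable (A M : Type*) [CommRing A] [AddCommGroup M] [Module A M]

lemma single_eq_X_pow_smul (i : ℕ) (m : M) :
    single A i m = (X ^ i : A[X]) • single A 0 m := by
  rw [← monomial_one_right_eq_X_pow, monomial_smul_single]
  simp

lemma coeff_map_self (f : M →ₗ[A] M) (z : PolynomialModule A M) (i : ℕ) :
    (map A f z).coeff i = f (z.coeff i) := by
  induction z using PolynomialModule.induction_linear with
  | zero => simp
  | add p q hp hq => simp [hp, hq]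
  | single j m =>
    rw [map_single]
    simp only [coeff_single, Finsupp.single_apply]
    split_ifs <;> simp

variable [Module A[X] M] [IsScalarTower A A[X] M]

/-- The evaluation map `∑ Xⁱ ⊗ mᵢ ↦ ∑ Xⁱ mᵢ` of an `A[X]`-module. -/
noncomputable def evalSelf : PolynomialModule A M →ₗ[A[X]] M :=
  (LinearMap.liftBaseChange A[X] (LinearMap.id : M →ₗ[A] M)).comp
    (polynomialTensorProductLEquivPolynomialModule A M).symm.toLinearMap

lemma evalSelf_single_zero (m : M) : evalSelf A M (single A 0 m) = m := by
  have : (polynomialTensorProductLEquivPolynomialModule A M).symm (single A 0 m) =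
      (1 : A[X]) ⊗ₜ[A] m := by
    rw [LinearEquiv.symm_apply_eq]
    change _ = LinearMap.liftBaseChange A[X] (lsingle A 0) _
    rw [LinearMap.liftBaseChange_tmul, one_smul]
    rfl
  simp [evalSelf, this]

lemma evalSelf_single (i : ℕ) (m : M) :
    evalSelf A M (single A i m) = (X ^ i : A[X]) • m := by
  rw [single_eq_X_pow_smul, _root_.map_smul, evalSelf_single_zero]

/-- The map `p ⊗ m ↦ X p ⊗ m - p ⊗ X m`. -/
noncomputable def subX : PolynomialModule A M →ₗ[A[X]] PolynomialModule A M where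
  toFun z := (X : A[X]) • z - map A ((LinearMap.lsmul A[X] M X).restrictScalars A) z
  map_add' x y := by simp only [smul_add, map_add]; abel
  map_smul' p x := by
    rw [map_smul, Algebra.algebraMap_self, Polynomial.map_id]
    simp only [RingHom.id_apply, smul_sub, smul_smul, mul_comm]

lemma subX_apply (z : PolynomialModule A M) : subX A M z =
    (X : A[X]) • z - map A ((LinearMap.lsmul A[X] M X).restrictScalars A) z := rfl

lemma coeff_subX_succ (z : PolynomialModule A M) (i : ℕ) :
    (subX A M z).coeff (i + 1) = z.coeff i - (X : A[X]) • z.coeff (i + 1) := by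
  have h : ((X : A[X]) • z).coeff (i + 1) = z.coeff i := by
    rw [← monomial_one_one_eq_X, monomial_smul_apply]; simp
  have h' := coeff_map_self A M ((LinearMap.lsmul A[X] M X).restrictScalars A) z (i + 1)
  change ((X : A[X]) • z).coeff (i + 1) - (map A _ z).coeff (i + 1) = _
  rw [h, h']
  rfl

/-- On the kernel `zᵢ = X zᵢ₊₁`, hence `zᵢ = X ^ j zᵢ₊ⱼ` for every `j`, which vanishes once `i + j`
exceeds the degree of `z`. -/
lemma subX_injective : Function.Injective (subX A M) := by
  rw [injective_iff_map_eq_zero]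
  intro z hz
  have hstep (i : ℕ) : z.coeff i = (X : A[X]) • z.coeff (i + 1) := by
    have := coeff_subX_succ A M z i
    rw [hz, coeff_zero, Finsupp.zero_apply, eq_comm, sub_eq_zero] at this
    exact this
  have hiter (i j : ℕ) : z.coeff i = (X ^ j : A[X]) • z.coeff (i + j) := by
    induction j with
    | zero => simp
    | succ j ih => rw [ih, hstep, smul_smul, ← pow_succ, add_assoc]
  rw [← coeff_eq_zero]
  ext i
  obtain ⟨N, hN⟩ := z.coeff.support.bddAbove
  have : z.coeff (i + (N + 1)) = 0 := by
    by_contra h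
    have := hN (Finset.mem_coe.mpr (Finsupp.mem_support_iff.mpr h))
    omega
  rw [hiter i (N + 1), this, smul_zero, Finsupp.zero_apply]

lemma subX_single (i : ℕ) (m : M) :
    subX A M (single A i m) = single A (i + 1) m - single A i ((X : A[X]) • m) := by
  rw [subX_apply, map_single, ← monomial_one_one_eq_X, monomial_smul_single, one_smul, add_comm]
  rfl

lemma evalSelf_subX (z : PolynomialModule A M) : evalSelf A M (subX A M z) = 0 := by
  induction z using PolynomialModule.induction_linear with
  | zero => simp
  | add p q hp hq => simp [hp, hq]
  | single i m =>
    rw [subX_single, map_sub, evalSelf_single, evalSelf_single, smul_smul, pow_succ, sub_self]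

/-- Modulo the range of `subX`, a power of the formal variable may be traded for the action of `X`
on `M`, so every element collapses to degree zero. This is the nontrivial half of exactness. -/
lemma sub_single_evalSelf_mem_range (z : PolynomialModule A M) :
    z - single A 0 (evalSelf A M z) ∈ LinearMap.range (subX A M) := by
  induction z using PolynomialModule.induction_linear with
  | zero => simp
  | add p q hp hq =>
    rw [map_add, single_add, add_sub_add_comm]
    exact add_mem hp hq
  | single i m =>
    rw [evalSelf_single]
    induction i generalizing m with
    | zero => simp
    | succ i ih =>
      have := add_mem (LinearMap.mem_range_self (subX A M) (single A i m)) (ih ((X : A[X]) • m))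
      rw [subX_single, sub_add_sub_cancel, smul_smul, ← pow_succ] at this
      exact this

lemma exact_subX_evalSelf : Function.Exact (subX A M) (evalSelf A M) := by
  intro z
  refine ⟨fun h ↦ ?_, ?_⟩
  · simpa [h] using sub_single_evalSelf_mem_range A M z
  · rintro ⟨y, rfl⟩
    exact evalSelf_subX A M y

lemma evalSelf_surjective : Function.Surjective (evalSelf A M) :=
  fun m ↦ ⟨_, evalSelf_single_zero A M m⟩

end PolynomialModule

namespace ModuleCat

/-- The projective dimension over `A[X]` exceeds that over `A` by at most one. -/
lemma hasProjectiveDimensionLE_polynomial {A : Type u} [CommRing A] (n : ℕ)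
    (M : Type u) [AddCommGroup M] [Module A M] [Module A[X] M] [IsScalarTower A A[X] M]
    (h : HasProjectiveDimensionLE (ModuleCat.of A M) n) :
    HasProjectiveDimensionLE (ModuleCat.of A[X] M) (n + 1) := by
  have h₁ : HasProjectiveDimensionLE (ModuleCat.of A[X] (PolynomialModule A M)) n :=
    have := hasProjectiveDimensionLE_baseChange (B := A[X]) n M h
    hasProjectiveDimensionLT_of_iso
      (PolynomialModule.polynomialTensorProductLEquivPolynomialModule A M).toModuleIso (n + 1)
  have hex := PolynomialModule.exact_subX_evalSelf A M
  have hS : (ModuleCat.shortComplexOfCompEqZero _ _ hex.linearMap_comp_eq_zero).ShortExact :=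
    ModuleCat.shortComplex_shortExact _ hex (PolynomialModule.subX_injective A M)
      (PolynomialModule.evalSelf_surjective A M)
  exact hS.hasProjectiveDimensionLT_X₃ (n + 1) h₁
    (hasProjectiveDimensionLT_of_ge _ (n + 1) _ (by omega))

/-- Transport of projective dimension bounds along a ring isomorphism. -/
lemma hasProjectiveDimensionLE_of_ringEquiv {R R' : Type u} [CommRing R] [CommRing R']
    (e : R ≃+* R') (M : Type u) [AddCommGroup M] [Module R M] [Module R' M]
    (he : ∀ (r : R) (m : M), e r • m = r • m) (n : ℕ)
    (h : HasProjectiveDimensionLE (ModuleCat.of R M) n) :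
    HasProjectiveDimensionLE (ModuleCat.of R' M) n :=
  have := RingHomInvPair.of_ringEquiv e
  have := RingHomInvPair.of_ringEquiv e.symm
  hasProjectiveDimensionLE_of_semiLinearEquiv (M := ModuleCat.of R M) (N := ModuleCat.of R' M) e
    { AddEquiv.refl M with map_smul' := fun r m ↦ (he r m).symm } n

/-- The projective dimension over a polynomial ring in `s` variables over `A` exceeds that over `A`
by at most `s`. -/
lemma hasProjectiveDimensionLE_mvPolynomial {A : Type u} [CommRing A] (n : ℕ)
    (τ : Type) [Finite τ] (M : Type u) [AddCommGroup M] [Module A M] [Module (MvPolynomial τ A) M]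
    [IsScalarTower A (MvPolynomial τ A) M]
    (h : HasProjectiveDimensionLE (ModuleCat.of A M) n) :
    HasProjectiveDimensionLE (ModuleCat.of (MvPolynomial τ A) M) (n + Nat.card τ) := by
  revert M
  induction τ using Finite.induction_empty_option with
  | of_equiv e ih =>
    rename_i σ τ
    intro M _ _ _ _ h
    let : Module (MvPolynomial σ A) M :=
      Module.compHom M (MvPolynomial.renameEquiv A e).toRingEquiv.toRingHom
    have : IsScalarTower A (MvPolynomial σ A) M := by
      refine .of_algebraMap_smul fun r m ↦ ?_
      change MvPolynomial.rename e (MvPolynomial.C r) • m = _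
      rw [MvPolynomial.rename_C]
      exact algebraMap_smul (MvPolynomial τ A) r m
    rw [← Nat.card_congr e]
    exact hasProjectiveDimensionLE_of_ringEquiv (MvPolynomial.renameEquiv A e).toRingEquiv M
      (fun _ _ ↦ rfl) _ (ih M h)
  | h_empty =>
    intro M _ _ _ _ h
    rw [Nat.card_eq_zero.mpr (.inl inferInstance), add_zero]
    refine hasProjectiveDimensionLE_of_ringEquiv
      (MvPolynomial.isEmptyRingEquiv A PEmpty).symm M (fun r m ↦ ?_) n h
    exact algebraMap_smul (MvPolynomial PEmpty A) r m
  | h_option ih =>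
    rename_i τ _
    intro M _ _ _ _ h
    let e := MvPolynomial.optionEquivLeft A τ
    let : Module (MvPolynomial τ A)[X] M := Module.compHom M e.symm.toRingEquiv.toRingHom
    let : Module (MvPolynomial τ A) M := Module.compHom M (C : MvPolynomial τ A →+* _)
    have : IsScalarTower (MvPolynomial τ A) (MvPolynomial τ A)[X] M :=
      .of_algebraMap_smul fun r m ↦ rfl
    have : IsScalarTower A (MvPolynomial τ A) M := by
      refine .of_algebraMap_smul fun r m ↦ ?_
      change e.symm (C (MvPolynomial.C r)) • m = _
      rw [MvPolynomial.optionEquivLeft_symm_C_C]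
      exact algebraMap_smul (MvPolynomial (Option τ) A) r m
    rw [Finite.card_option, ← add_assoc]
    exact hasProjectiveDimensionLE_of_ringEquiv e.symm.toRingEquiv M (fun _ _ ↦ rfl) _
      (hasProjectiveDimensionLE_polynomial _ M (ih M h))

end ModuleCat

/-! ### Nonvanishing Ext and the residue field at the origin -/

namespace ModuleCat

/-- An element that kills `K` and acts injectively on `L` shifts nonvanishing of `Ext L K` to the
next degree of `Ext (L / xL) K`. -/
lemma exists_ext_succ_ne_zero {R : Type u} [CommRing R] {L N K : ModuleCat.{u} R} (x : R)
    (g : L ⟶ N) (w : (x • 𝟙 L) ≫ g = 0) (hS : (ShortComplex.mk (x • 𝟙 L) g w).ShortExact)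
    (hK : ∀ m : K, x • m = 0) {n : ℕ} (h : ∃ e : Ext L K n, e ≠ 0) :
    ∃ e : Ext N K (n + 1), e ≠ 0 := by
  obtain ⟨e, he⟩ := h
  refine ⟨hS.extClass.comp e (add_comm 1 n), fun h0 ↦ he ?_⟩
  -- If the connecting map killed `e`, then `e` would be `x` times some `e'`; the scalar can be
  -- moved to `K`, where it acts as zero.
  obtain ⟨e', rfl⟩ := Ext.contravariant_sequence_exact₁ hS _ e (add_comm 1 n) h0
  have hx : x • 𝟙 K = 0 := by
    ext m
    exact hK m
  change (Ext.mk₀ (x • 𝟙 L)).comp e' _ = 0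
  rw [Ext.mk₀_smul, Ext.smul_comp, Ext.mk₀_id_comp, Ext.smul_eq_comp_mk₀, hx, Ext.mk₀_zero,
    Ext.comp_zero]

end ModuleCat

namespace MvPolynomial

variable {σ : Type} {k : Type u} [Field k]

/-- Membership in an ideal of variables is tested monomial by monomial, and a factor `X j` does not
affect exponents at `s`. Thus the variables form a regular sequence. -/
lemma mem_span_X_image_of_X_mul_mem {s : Set σ} {j : σ} (hj : j ∉ s) {p : MvPolynomial σ k}
    (h : X j * p ∈ Ideal.span (X '' s : Set (MvPolynomial σ k))) :
    p ∈ Ideal.span (X '' s : Set (MvPolynomial σ k)) := by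
  rw [mem_ideal_span_X_image] at h ⊢
  intro m hm
  obtain ⟨i, hi, hne⟩ := h (Finsupp.single j 1 + m) (by
    rw [mem_support_iff, coeff_X_mul]
    exact mem_support_iff.mp hm)
  refine ⟨i, hi, ?_⟩
  have : j ≠ i := fun h ↦ hj (h ▸ hi)
  simpa [Finsupp.single_apply, this] using hne

/-- Variables are killed one at a time: `X j` is regular on the current quotient and zero on `K`, so
each one raises the nonvanishing degree by one. The induction starts from a nonzero homomorphism `R
→ K`. -/
lemma exists_ext_quotient_span_X_ne_zero (K : ModuleCat.{u} (MvPolynomial σ k)) [Nontrivial K]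
    (hK : ∀ (i : σ) (m : K), (X i : MvPolynomial σ k) • m = 0) (s : Finset σ) :
    ∃ e : Ext (ModuleCat.of (MvPolynomial σ k)
      (MvPolynomial σ k ⧸ Ideal.span (X '' (s : Set σ) : Set (MvPolynomial σ k)))) K s.card,
      e ≠ 0 := by
  classical
  induction s using Finset.induction_on with
  | empty =>
    obtain ⟨m, hm⟩ := exists_ne (0 : K)
    let f : (MvPolynomial σ k ⧸
        Ideal.span (X '' ((∅ : Finset σ) : Set σ) : Set (MvPolynomial σ k))) →ₗ[MvPolynomial σ k] K :=
      Submodule.liftQ _ (LinearMap.toSpanSingleton _ K m) (by simp)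
    refine ⟨Ext.mk₀ (ModuleCat.ofHom f), fun h ↦ hm ?_⟩
    have h' : ModuleCat.ofHom f = 0 := (Ext.mk₀_eq_zero_iff _).mp h
    have h₁ : f (Submodule.Quotient.mk 1) = 0 :=
      congrArg (fun φ ↦ φ.hom (Submodule.Quotient.mk 1)) h'
    have h₂ : f (Submodule.Quotient.mk 1) = (1 : MvPolynomial σ k) • m :=
      Submodule.liftQ_apply _ _ _
    rw [← one_smul (MvPolynomial σ k) m, ← h₂, h₁]
  | insert j s hj ih =>
    rw [Finset.card_insert_of_notMem hj]
    set I := Ideal.span (X '' (s : Set σ) : Set (MvPolynomial σ k)) with hI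
    set J := Ideal.span (X '' ((insert j s : Finset σ) : Set σ) : Set (MvPolynomial σ k)) with hJ
    have hJI : J = Ideal.span {X j} ⊔ I := by
      rw [hJ, Finset.coe_insert, Set.image_insert_eq, Ideal.span_insert]
    have hIJ : I ≤ J := hJI ▸ le_sup_right
    let g : (MvPolynomial σ k ⧸ I) →ₗ[MvPolynomial σ k] (MvPolynomial σ k ⧸ J) :=
      Submodule.factor hIJ
    have hex : Function.Exact
        (LinearMap.lsmul (MvPolynomial σ k) (MvPolynomial σ k ⧸ I) (X j)) g := by
      intro y
      obtain ⟨p, rfl⟩ := Submodule.Quotient.mk_surjective _ y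
      constructor
      · intro h
        have hp : p ∈ J := (Submodule.Quotient.mk_eq_zero J).mp h
        rw [hJI, Ideal.mem_span_singleton_sup] at hp
        obtain ⟨r, b, hb, rfl⟩ := hp
        refine ⟨Submodule.Quotient.mk r, ?_⟩
        rw [LinearMap.lsmul_apply, ← Submodule.Quotient.mk_smul, Submodule.Quotient.eq]
        simpa [mul_comm] using hb
      · rintro ⟨z, hz⟩
        obtain ⟨r, rfl⟩ := Submodule.Quotient.mk_surjective _ z
        rw [← hz, LinearMap.lsmul_apply, ← Submodule.Quotient.mk_smul]
        refine (Submodule.Quotient.mk_eq_zero J).mpr ?_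
        rw [hJI, smul_eq_mul, mul_comm]
        exact Ideal.mem_sup_left (Ideal.mul_mem_left _ _ (Ideal.mem_span_singleton_self _))
    have hinj : Function.Injective
        (LinearMap.lsmul (MvPolynomial σ k) (MvPolynomial σ k ⧸ I) (X j)) := by
      rw [injective_iff_map_eq_zero]
      intro y hy
      obtain ⟨p, rfl⟩ := Submodule.Quotient.mk_surjective _ y
      rw [LinearMap.lsmul_apply, ← Submodule.Quotient.mk_smul, Submodule.Quotient.mk_eq_zero] at hy
      exact (Submodule.Quotient.mk_eq_zero I).mpr (mem_span_X_image_of_X_mul_mem (by simpa) hy)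
    exact ModuleCat.exists_ext_succ_ne_zero (X j) (ModuleCat.ofHom g)
      (by ext1; exact hex.linearMap_comp_eq_zero)
      (ModuleCat.shortComplex_shortExact _ hex hinj (Submodule.factor_surjective hIJ)) (hK j) ih

/-- The residue field at the origin of a polynomial ring in `n` variables does not have projective
dimension less than `n`. -/
lemma not_hasProjectiveDimensionLT_quotient_idealOfVars [Finite σ] :
    ¬ HasProjectiveDimensionLT (ModuleCat.of (MvPolynomial σ k)
      (MvPolynomial σ k ⧸ Ideal.span (Set.range X : Set (MvPolynomial σ k)))) (Nat.card σ) := by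
  intro h
  have := Fintype.ofFinite σ
  have hne : Ideal.span (Set.range X : Set (MvPolynomial σ k)) ≠ ⊤ := by
    rw [Ideal.ne_top_iff_one, ← Set.image_univ, mem_ideal_span_X_image]
    intro h
    obtain ⟨i, -, hi⟩ := h 0 (by simp)
    exact hi rfl
  have : Nontrivial (MvPolynomial σ k ⧸ Ideal.span (Set.range X : Set (MvPolynomial σ k))) :=
    Ideal.Quotient.nontrivial_iff.mpr hne
  obtain ⟨e, he⟩ := exists_ext_quotient_span_X_ne_zero
    (ModuleCat.of (MvPolynomial σ k)
      (MvPolynomial σ k ⧸ Ideal.span (Set.range X : Set (MvPolynomial σ k)))) (by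
      intro i m
      obtain ⟨p, rfl⟩ := Submodule.Quotient.mk_surjective _ m
      refine (Submodule.Quotient.mk_eq_zero _).mpr ?_
      exact Ideal.mul_mem_right _ _ (Ideal.subset_span ⟨i, rfl⟩)) Finset.univ
  rw [← Set.image_univ, ← Finset.coe_univ] at h
  exact he (e.eq_zero_of_hasProjectiveDimensionLT (Nat.card σ) (by simp))

end MvPolynomial

/-! ### Freeness over one variable -/

namespace Polynomial

/-- If multiplication by `X` permutes a `k`-basis injectively and without infinite backward orbits,
then the module is free over `k[X]`. -/
lemma free_of_basis_shift {k M ι : Type*} [Field k] [AddCommGroup M] [Module k M]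
    [Module k[X] M] [IsScalarTower k k[X] M] (b : Module.Basis ι k M) (s : ι → ι)
    (hs : Function.Injective s) (hX : ∀ i, (X : k[X]) • b i = b (s i)) (deg : ι → ℕ)
    (hdeg : ∀ i, deg i < deg (s i)) : Module.Free k[X] M := by
  -- `W` collects the starting points of the `s`-orbits. Each index is `s^[j] w` for a unique pair
  -- `(j, w)`: uniqueness by injectivity of `s`, existence by descent on `deg`. So `W` indexes a
  -- `k[X]`-basis.
  let W := {i // i ∉ Set.range s}
  let E : ℕ × W → ι := fun x ↦ s^[x.1] x.2.1
  have hinj : Function.Injective E := by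
    have key (j : ℕ) : ∀ (l : ℕ) (w w' : W), s^[j] w.1 = s^[l] w'.1 → (j, w) = (l, w') := by
      induction j with
      | zero =>
        rintro (_ | l) w w' h
        · exact Prod.ext rfl (Subtype.ext h)
        · rw [Function.iterate_succ_apply'] at h
          exact absurd ⟨_, h.symm⟩ w.2
      | succ j ih =>
        rintro (_ | l) w w' h
        · rw [Function.iterate_succ_apply'] at h
          exact absurd ⟨_, h⟩ w'.2
        · rw [Function.iterate_succ_apply', Function.iterate_succ_apply'] at h
          have := ih l w w' (hs h)
          simp only [Prod.mk.injEq] at this ⊢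
          exact ⟨by omega, this.2⟩
    rintro ⟨j, w⟩ ⟨l, w'⟩ h
    exact key j l w w' h
  have hsurj : Function.Surjective E := by
    intro i
    induction hd : deg i using Nat.strong_induction_on generalizing i with
    | _ d ih =>
      by_cases hi : i ∈ Set.range s
      · obtain ⟨i', rfl⟩ := hi
        obtain ⟨⟨j, w⟩, hj⟩ := ih _ (hd ▸ hdeg i') i' rfl
        exact ⟨(j + 1, w), by rw [← hj]; exact Function.iterate_succ_apply' s j w.1⟩
      · exact ⟨(0, ⟨i, hi⟩), rfl⟩
  let c : Module.Basis (ℕ × W) k (W →₀ k[X]) :=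
    (Polynomial.basisMonomials k).smulTower (Finsupp.basisSingleOne : Module.Basis W k[X] _)
  let L : (W →₀ k[X]) →ₗ[k[X]] M := Finsupp.linearCombination k[X] fun w : W ↦ b w.1
  let e : (W →₀ k[X]) ≃ₗ[k] M := c.equiv b (Equiv.ofBijective E ⟨hinj, hsurj⟩)
  have hpow (j : ℕ) (i : ι) : (X ^ j : k[X]) • b i = b (s^[j] i) := by
    induction j with
    | zero => simp
    | succ j ih => rw [pow_succ', mul_smul, ih, hX, Function.iterate_succ_apply']
  have hL : L.restrictScalars k = e.toLinearMap := by
    refine c.ext fun x ↦ ?_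
    have h₁ : e (c x) = b (E x) := by
      simp only [e, Module.Basis.equiv_apply]
      rfl
    rw [LinearEquiv.coe_coe, h₁]
    simp [c, L, E, ← hpow, monomial_one_right_eq_X_pow]
  have hbij : Function.Bijective L := by
    have : (L : (W →₀ k[X]) → M) = e := congrArg DFunLike.coe hL
    rw [this]
    exact e.bijective
  exact Module.Free.of_equiv (LinearEquiv.ofBijective L hbij)

end Polynomial

namespace MvPolynomial

/-- A module over a polynomial ring in `n` variables that is free over the subring generated by one
of the variables has projective dimension less than `n`. -/
lemma hasProjectiveDimensionLT_card_of_basis {σ : Type} [Finite σ] {k : Type u} [Field k]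
    (M : Type u) [AddCommGroup M] [Module k M] [Module (MvPolynomial σ k) M]
    [IsScalarTower k (MvPolynomial σ k) M] {ι : Type*} (b : Module.Basis ι k M) (x : σ) (s : ι → ι)
    (hs : Function.Injective s) (hX : ∀ i, (X x : MvPolynomial σ k) • b i = b (s i)) (deg : ι → ℕ)
    (hdeg : ∀ i, deg i < deg (s i)) :
    HasProjectiveDimensionLT (ModuleCat.of (MvPolynomial σ k) M) (Nat.card σ) := by
  classical
  let τ := {y // y ≠ x}
  -- The distinguished variable `x` is absorbed into the coefficient ring `k[X]`; the remaining
  -- variables are counted by `Nat.card σ - 1`.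
  let e : MvPolynomial τ k[X] ≃ₐ[k] MvPolynomial σ k :=
    (optionEquivRight k τ).symm.trans (renameEquiv k (Equiv.optionSubtypeNe x))
  let : Module (MvPolynomial τ k[X]) M := Module.compHom M e.toRingEquiv.toRingHom
  let : Module k[X] M := Module.compHom M (C : k[X] →+* MvPolynomial τ k[X])
  have : IsScalarTower k[X] (MvPolynomial τ k[X]) M := .of_algebraMap_smul fun _ _ ↦ rfl
  have hC (r : k) : e (C (Polynomial.C r)) = C r := by
    have : (optionEquivRight k τ).symm (C (Polynomial.C r)) = C r := by
      rw [AlgEquiv.symm_apply_eq, optionEquivRight_C]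
    simp [e, this]
  have heX : e (C Polynomial.X) = X x := by
    have : (optionEquivRight k τ).symm (C Polynomial.X) = X none := by
      rw [AlgEquiv.symm_apply_eq, optionEquivRight_X_none]
    simp only [e, AlgEquiv.trans_apply, this, renameEquiv_apply, rename_X]
    rfl
  have : IsScalarTower k k[X] M := by
    refine .of_algebraMap_smul fun r m ↦ ?_
    change e (C (Polynomial.C r)) • m = _
    rw [hC]
    exact algebraMap_smul (MvPolynomial σ k) r m
  have : Module.Free k[X] M := Polynomial.free_of_basis_shift b s hs (fun i ↦ by
    change e (C Polynomial.X) • b i = _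
    rw [heX, hX]) deg hdeg
  have h0 : HasProjectiveDimensionLE (ModuleCat.of k[X] M) 0 :=
    projective_iff_hasProjectiveDimensionLE_zero _ |>.mp
      ((IsProjective.iff_projective _).mp inferInstance)
  have h1 := ModuleCat.hasProjectiveDimensionLE_of_ringEquiv e.toRingEquiv M (fun _ _ ↦ rfl) _
    (ModuleCat.hasProjectiveDimensionLE_mvPolynomial 0 τ M h0)
  have hcard : Nat.card σ = 0 + Nat.card τ + 1 := by
    rw [← Nat.card_congr (Equiv.optionSubtypeNe x), Finite.card_option, zero_add]
  rw [hcard]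
  exact h1

end MvPolynomial

end ProjectiveDimension

/-! ### Monomial modules and the criterion for maximal projective dimension -/

section SemigroupModule

open CategoryTheory

namespace AffineSemigroup

section WeightedModule

variable (k : Type u) [Field k] {σ G : Type} [AddCancelCommMonoid G]

/-- The semigroup ring `k[G]`, regarded as a module over the polynomial ring `k[x_i : i ∈ σ]`, where
`x_i` acts as multiplication by `t ^ (w i)`. -/
def WeightedModule (_ : σ → G) : Type u := AddMonoidAlgebra k G

variable {k} {w : σ → G}

noncomputable instance : AddCommGroup (WeightedModule k w) :=
  inferInstanceAs (AddCommGroup (AddMonoidAlgebra k G))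

noncomputable instance : Module k (WeightedModule k w) :=
  inferInstanceAs (Module k (AddMonoidAlgebra k G))

noncomputable instance : Module (MvPolynomial σ k) (WeightedModule k w) :=
  Module.compHom (AddMonoidAlgebra k G)
    (MvPolynomial.aeval fun i ↦ AddMonoidAlgebra.single (w i) (1 : k)).toRingHom

namespace WeightedModule

/-- The element of the semigroup ring underlying an element of `WeightedModule k w`. -/
def toAlgebra (p : WeightedModule k w) : AddMonoidAlgebra k G := p

/-- The coefficients of an element of `WeightedModule k w`. -/
noncomputable def coeff : WeightedModule k w ≃ₗ[k] (G →₀ k) := AddMonoidAlgebra.coeffLinearEquiv k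

lemma toAlgebra_smul (r : MvPolynomial σ k) (p : WeightedModule k w) :
    (r • p).toAlgebra = (MvPolynomial.aeval fun i ↦ AddMonoidAlgebra.single (w i) (1 : k)) r *
      p.toAlgebra := rfl

instance : IsScalarTower k (MvPolynomial σ k) (WeightedModule k w) := by
  refine .of_algebraMap_smul fun r p ↦ ?_
  have := toAlgebra_smul (algebraMap k (MvPolynomial σ k) r) p
  rw [AlgHom.commutes, ← Algebra.smul_def] at this
  exact this

lemma toAlgebra_X_smul (i : σ) (p : WeightedModule k w) :
    ((MvPolynomial.X i : MvPolynomial σ k) • p).toAlgebra =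
      AddMonoidAlgebra.single (w i) (1 : k) * p.toAlgebra := by
  rw [toAlgebra_smul, MvPolynomial.aeval_X]

lemma C_smul (r : k) (p : WeightedModule k w) : (MvPolynomial.C r : MvPolynomial σ k) • p = r • p :=
  algebraMap_smul (MvPolynomial σ k) r p

lemma coeff_X_smul_add (i : σ) (p : WeightedModule k w) (g : G) :
    ((MvPolynomial.X i : MvPolynomial σ k) • p).coeff (w i + g) = p.coeff g := by
  change ((MvPolynomial.X i : MvPolynomial σ k) • p).toAlgebra.coeff (w i + g) = p.toAlgebra.coeff g
  rw [toAlgebra_X_smul, AddMonoidAlgebra.coeff_single_mul_eq_mul_coeff g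
    fun m _ ↦ add_right_inj (w i), one_mul]

lemma coeff_X_smul_of_forall_ne (i : σ) (p : WeightedModule k w) (g : G)
    (h : ∀ g', w i + g' ≠ g) :
    ((MvPolynomial.X i : MvPolynomial σ k) • p).coeff g = 0 := by
  change ((MvPolynomial.X i : MvPolynomial σ k) • p).toAlgebra.coeff g = 0
  rw [toAlgebra_X_smul, AddMonoidAlgebra.coeff_single_mul_of_forall_add_ne _ _ h]

lemma X_smul_coeff_symm_single (i : σ) (g : G) (c : k) :
    (MvPolynomial.X i : MvPolynomial σ k) • (coeff.symm (Finsupp.single g c) : WeightedModule k w) =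
      coeff.symm (Finsupp.single (w i + g) c) := by
  change ((MvPolynomial.X i : MvPolynomial σ k) •
    (coeff.symm (Finsupp.single g c) : WeightedModule k w)).toAlgebra = AddMonoidAlgebra.single _ _
  rw [toAlgebra_X_smul]
  exact (AddMonoidAlgebra.single_mul_single _ _ _ _).trans (by rw [one_mul])

variable (k) in
/-- The submodule spanned by the monomials `t ^ g`, `g ∈ Y`, for a set `Y` that is stable under
adding the weights. -/
noncomputable def supported (Y : Set G) (hY : ∀ i, ∀ g ∈ Y, w i + g ∈ Y) :
    Submodule (MvPolynomial σ k) (WeightedModule k w) where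
  carrier := {p | p.coeff ∈ Finsupp.supported k k Y}
  add_mem' {p q} hp hq := by
    simp only [Set.mem_ofPred_eq, map_add] at *
    exact add_mem hp hq
  zero_mem' := by simp
  smul_mem' r p hp := by
    simp only [Set.mem_ofPred_eq] at *
    induction r using MvPolynomial.induction_on generalizing p with
    | C c =>
      rw [C_smul, map_smul]
      exact Submodule.smul_mem _ _ hp
    | add r s hr hs =>
      rw [add_smul, map_add]
      exact add_mem (hr p hp) (hs p hp)
    | mul_X r i hr =>
      rw [mul_smul]
      refine hr _ ?_
      rw [Finsupp.mem_supported']  at hp ⊢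
      intro g hg
      by_cases h : ∀ g', w i + g' ≠ g
      · exact coeff_X_smul_of_forall_ne i p g h
      · push Not at h
        obtain ⟨g', rfl⟩ := h
        rw [coeff_X_smul_add]
        exact hp g' fun hg' ↦ hg (hY i g' hg')

variable {Y : Set G} {hY : ∀ i, ∀ g ∈ Y, w i + g ∈ Y}

lemma mem_supported {p : WeightedModule k w} : p ∈ supported k Y hY ↔ ∀ g ∉ Y, p.coeff g = 0 :=
  Finsupp.mem_supported' k p.coeff

/-- The monomials `t ^ g`, `g ∈ Y`, form a basis of `supported k Y hY`. -/
noncomputable def supportedBasis : Module.Basis Y k (supported k Y hY) :=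
  let e : supported k Y hY ≃ₗ[k] Finsupp.supported k k Y :=
    { toFun p := ⟨coeff p.1, p.2⟩
      invFun p := ⟨(coeff (w := w)).symm p.1, by
        change coeff ((coeff (w := w)).symm p.1) ∈ Finsupp.supported k k Y
        rw [LinearEquiv.apply_symm_apply]
        exact p.2⟩
      left_inv p := by simp
      right_inv p := by simp
      map_add' p q := rfl
      map_smul' r p := rfl }
  .ofRepr (e.trans (Finsupp.supportedEquivFinsupp Y))

lemma coe_supportedBasis (g : Y) : ((supportedBasis g : supported k Y hY) : WeightedModule k w) =
    coeff.symm (Finsupp.single g.1 1) := by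
  classical
  simp [supportedBasis, Module.Basis.coe_ofRepr]

/-- Adding `w i` is injective on `Y` by cancellation and strictly raises `deg`, so the module is
free over `k[x_i]`. -/
lemma hasProjectiveDimensionLT_supported [Finite σ] (i : σ) (deg : G → ℕ)
    (hdeg : ∀ g, deg g < deg (w i + g)) :
    HasProjectiveDimensionLT (ModuleCat.of (MvPolynomial σ k) (supported k Y hY)) (Nat.card σ) := by
  refine MvPolynomial.hasProjectiveDimensionLT_card_of_basis (supported k Y hY) supportedBasis i
    (fun g ↦ ⟨w i + g.1, hY i g.1 g.2⟩) ?_ ?_ (fun g ↦ deg g.1) fun g ↦ hdeg g.1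
  · intro g g' h
    exact Subtype.ext (add_left_cancel (congrArg Subtype.val h))
  · intro g
    refine Subtype.ext ?_
    rw [Submodule.coe_smul, coe_supportedBasis, coe_supportedBasis, X_smul_coeff_symm_single]

/-- The coefficient at a point of `Y` that is not of the form `w i + g`, as a linear map to the
residue field at the origin. -/
noncomputable def coeffAt (f : G) (hf : ∀ i, ∀ g ∈ Y, w i + g ≠ f) :
    supported k Y hY →ₗ[MvPolynomial σ k]
      (MvPolynomial σ k ⧸ Ideal.span (Set.range MvPolynomial.X : Set (MvPolynomial σ k))) where
  toFun p := Ideal.Quotient.mk _ (MvPolynomial.C (coeff p.1 f))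
  map_add' p q := by simp
  map_smul' r p := by
    simp only [RingHom.id_apply]
    induction r using MvPolynomial.induction_on generalizing p with
    | C c =>
      rw [Submodule.coe_smul, C_smul, map_smul, Finsupp.smul_apply, smul_eq_mul, map_mul, map_mul]
      rfl
    | add r s hr hs =>
      rw [add_smul, add_smul, ← hr, ← hs]
      simp
    | mul_X r i hr =>
      rw [mul_smul, hr, mul_smul]
      congr 1
      have h0 : coeff ((MvPolynomial.X i : MvPolynomial σ k) • p : supported k Y hY).1 f = 0 := by
        rw [Submodule.coe_smul]
        by_cases h : ∀ g', w i + g' ≠ f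
        · exact coeff_X_smul_of_forall_ne i p.1 f h
        · push Not at h
          obtain ⟨g', rfl⟩ := h
          rw [coeff_X_smul_add]
          exact mem_supported.mp p.2 g' fun hg ↦ hf i g' hg rfl
      rw [h0, map_zero, map_zero]
      refine (Ideal.Quotient.eq_zero_iff_mem.mpr ?_).symm
      exact Ideal.mul_mem_right _ _ (Ideal.subset_span ⟨i, rfl⟩)

lemma coeffAt_apply (f : G) (hf : ∀ i, ∀ g ∈ Y, w i + g ≠ f) (p : supported k Y hY) :
    coeffAt f hf p = Ideal.Quotient.mk _ (MvPolynomial.C (coeff p.1 f)) := rfl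

lemma coeffAt_eq_zero_iff {f : G} {hf : ∀ i, ∀ g ∈ Y, w i + g ≠ f} {p : supported k Y hY} :
    coeffAt f hf p = 0 ↔ coeff p.1 f = 0 := by
  rw [coeffAt_apply, Ideal.Quotient.eq_zero_iff_mem, ← Set.image_univ,
    MvPolynomial.mem_ideal_span_X_image]
  refine ⟨fun h ↦ ?_, fun h ↦ by simp [h]⟩
  by_contra hne
  obtain ⟨i, -, hi⟩ := h 0 (by simpa using hne)
  exact hi rfl

lemma coeffAt_surjective {f : G} {hf : ∀ i, ∀ g ∈ Y, w i + g ≠ f} (hfY : f ∈ Y) :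
    Function.Surjective (coeffAt f hf : supported k Y hY →ₗ[MvPolynomial σ k] _) := by
  have h1 : coeffAt f hf (supportedBasis (k := k) (hY := hY) ⟨f, hfY⟩) =
      Ideal.Quotient.mk _ 1 := by
    rw [coeffAt_apply, coe_supportedBasis, LinearEquiv.apply_symm_apply, Finsupp.single_eq_same,
      map_one]
  intro y
  obtain ⟨r, rfl⟩ := Ideal.Quotient.mk_surjective y
  refine ⟨r • supportedBasis ⟨f, hfY⟩, ?_⟩
  rw [map_smul, h1]
  exact congrArg (Ideal.Quotient.mk _) (mul_one r)

end WeightedModule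
end WeightedModule

section MPD

variable {d : ℕ} (k : Type u) [Field k] (S : AddSubmonoid (Fin d → ℕ))

/-- The inclusion of the semigroup ring of `S` into that of `ℕ ^ d`. -/
noncomputable def toWeightedModule : semigroupModule k S →ₗ[MvPolynomial (minGens S) k]
    WeightedModule k (fun a : minGens S ↦ a.1) where
  toFun p := AddMonoidAlgebra.mapDomain S.subtype (p : AddMonoidAlgebra k S)
  map_add' p q := AddMonoidAlgebra.mapDomain_add _ _ _
  map_smul' r p := by
    change AddMonoidAlgebra.mapDomainAlgHom k k S.subtype 
        (presentation k S r * (show AddMonoidAlgebra k S from p)) =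
      (MvPolynomial.aeval fun i : minGens S ↦ AddMonoidAlgebra.single i.1 (1 : k)) r *
        AddMonoidAlgebra.mapDomainAlgHom k k S.subtype (show AddMonoidAlgebra k S from p)
    rw [map_mul]
    congr 1
    rw [← AlgHom.comp_apply]
    congr 1
    ext a
    simp [presentation]

lemma toWeightedModule_injective : Function.Injective (toWeightedModule k S) :=
  AddMonoidAlgebra.mapDomain_injective Subtype.val_injective

variable {k S}

lemma mem_range_toWeightedModule_iff {p : WeightedModule k (fun a : minGens S ↦ a.1)} :
    p ∈ LinearMap.range (toWeightedModule k S) ↔ ∀ g ∉ S, p.coeff g = 0 := by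
  constructor
  · rintro ⟨q, rfl⟩ g hg
    exact Finsupp.mapDomain_of_notMem_range _ _ (by simpa using hg)
  · intro h
    obtain ⟨q, hq⟩ := (Finsupp.mem_range_mapDomain_iff S.subtype Subtype.val_injective p.coeff).mpr
      fun g hg ↦ h g fun hg' ↦ hg ⟨⟨g, hg'⟩, rfl⟩
    exact ⟨AddMonoidAlgebra.ofCoeff q, congrArg AddMonoidAlgebra.ofCoeff hq⟩

/-- The pseudo-Frobenius property is exactly what makes `S ∪ {f}` stable under `S` with
one-dimensional quotient `K`. The lower bound comes from comparing `k[S]` with the monomial module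
of `S ∪ {f}`. -/
theorem isMPD_of_PF_nonempty (hfg : S.FG) (hfin : (minGens S).Finite)
    (hne : (minGens S).Nonempty) (hPF : (PF S).Nonempty) : IsMPD k S := by
  refine ⟨hfg, ?_⟩
  have : Finite (minGens S) := hfin
  obtain ⟨f, ⟨-, hfS⟩, hf⟩ := hPF
  obtain ⟨x, hx⟩ := hne
  let w : minGens S → (Fin d → ℕ) := fun a ↦ a.1
  have hdeg (g : Fin d → ℕ) : ∑ i, g i < ∑ i, (w ⟨x, hx⟩ + g) i := by
    have : ∑ i, x i ≠ 0 := fun h ↦ hx.2.1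
      (funext fun i ↦ by simpa using (Finset.sum_eq_zero_iff.mp h) i)
    simp only [w, Pi.add_apply, Finset.sum_add_distrib]
    omega
  have hS (i : minGens S) (g : Fin d → ℕ) (hg : g ∈ (S : Set (Fin d → ℕ))) : w i + g ∈ S :=
    S.add_mem i.2.1 hg
  have hY (i : minGens S) (g : Fin d → ℕ) (hg : g ∈ insert f (S : Set (Fin d → ℕ))) :
      w i + g ∈ insert f (S : Set (Fin d → ℕ)) := by
    rcases hg with rfl | hg
    · exact .inr (add_comm g _ ▸ hf _ i.2.1 i.2.2.1)
    · exact .inr (hS i g hg)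
  have hfY (i : minGens S) (g : Fin d → ℕ) (hg : g ∈ insert f (S : Set (Fin d → ℕ))) :
      w i + g ≠ f := by
    rcases hg with rfl | hg
    · exact fun h ↦ i.2.2.1 (by simpa using h)
    · exact fun h ↦ hfS (h ▸ hS i g hg)
  let N := WeightedModule.supported k _ hY
  have hN : HasProjectiveDimensionLT (ModuleCat.of (MvPolynomial (minGens S) k) N)
      (Nat.card (minGens S)) :=
    WeightedModule.hasProjectiveDimensionLT_supported ⟨x, hx⟩ (fun g ↦ ∑ i, g i) hdeg
  have hMN (p : semigroupModule k S) : toWeightedModule k S p ∈ N := by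
    refine WeightedModule.mem_supported.mpr fun g hg ↦ ?_
    exact mem_range_toWeightedModule_iff.mp ⟨p, rfl⟩ g fun h ↦ hg (.inr h)
  let j : semigroupModule k S →ₗ[MvPolynomial (minGens S) k] N :=
    (toWeightedModule k S).codRestrict N hMN
  have hex : Function.Exact j (WeightedModule.coeffAt f hfY) := by
    intro p
    rw [WeightedModule.coeffAt_eq_zero_iff]
    constructor
    · intro h
      obtain ⟨q, hq⟩ := (mem_range_toWeightedModule_iff (p := p.1)).mpr fun g hg ↦ by
        by_cases hgf : g = f
        · rw [hgf, h]
        · exact WeightedModule.mem_supported.mp p.2 g (by simp [hgf, hg])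
      exact ⟨q, Subtype.ext hq⟩
    · rintro ⟨q, rfl⟩
      exact mem_range_toWeightedModule_iff.mp ⟨q, rfl⟩ f hfS
  have hshort : (ModuleCat.shortComplexOfCompEqZero _ _ hex.linearMap_comp_eq_zero).ShortExact :=
    ModuleCat.shortComplex_shortExact _ hex
      (fun p q h ↦ toWeightedModule_injective k S (congrArg Subtype.val h))
      (WeightedModule.coeffAt_surjective (hf := hfY) (.inl rfl))
  have hM : HasProjectiveDimensionLT (semigroupModule k S) (Nat.card (minGens S)) := by
    -- The upper bound applies to `k[S]` itself, as the monomial submodule with exponents in `S`.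
    let N' := WeightedModule.supported k (S : Set (Fin d → ℕ)) hS
    have hN' : HasProjectiveDimensionLT (ModuleCat.of (MvPolynomial (minGens S) k) N')
        (Nat.card (minGens S)) :=
      WeightedModule.hasProjectiveDimensionLT_supported ⟨x, hx⟩ (fun g ↦ ∑ i, g i) hdeg
    have hrange : LinearMap.range (toWeightedModule k S) = N' := by
      ext p
      rw [mem_range_toWeightedModule_iff]
      exact WeightedModule.mem_supported.symm
    let e : N' ≃ₗ[MvPolynomial (minGens S) k] semigroupModule k S :=
      (LinearEquiv.ofEq _ _ hrange.symm).trans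
        (LinearEquiv.ofInjective _ (toWeightedModule_injective k S)).symm
    exact hasProjectiveDimensionLT_of_iso e.toModuleIso _
  obtain ⟨m, hm⟩ : ∃ m, Nat.card (minGens S) = m + 1 :=
    Nat.exists_eq_succ_of_ne_zero (Nat.card_ne_zero.mpr ⟨⟨⟨x, hx⟩⟩, inferInstance⟩)
  rw [hm] at hM hN
  have hle : projectiveDimension (semigroupModule k S) ≤ m :=
    (projectiveDimension_le_iff _ m).mpr hM
  have hge : m ≤ projectiveDimension (semigroupModule k S) := by
    rw [projectiveDimension_ge_iff]
    intro h
    refine MvPolynomial.not_hasProjectiveDimensionLT_quotient_idealOfVars (σ := minGens S) (k := k) ?_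
    rw [hm]
    exact hshort.hasProjectiveDimensionLT_X₃ m h hN
  have hcard : embDim S = m + 1 := hm
  rw [le_antisymm hle hge, hcard]
  norm_cast

end MPD

end AffineSemigroup

end SemigroupModule

namespace AffineSemigroup

/-! ### Minimal generators, finiteness of `PF(S)`, and cones -/

section Generators

variable {M : Type*} [AddCommMonoid M]

lemma minGens_closure_subset (A : Set M) : minGens (AddSubmonoid.closure A) ⊆ A := by
  rintro a ⟨ha, ha0, hirr⟩
  have key : ∀ x ∈ AddSubmonoid.closure A,
      x = 0 ∨ ∃ g ∈ A, g ≠ 0 ∧ ∃ y ∈ AddSubmonoid.closure A, x = g + y := by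
    intro x hx
    induction hx using AddSubmonoid.closure_induction_left with
    | zero => exact .inl rfl
    | add_left g hg y hy ih =>
      by_cases h0 : g = 0
      · simpa [h0] using ih
      · exact .inr ⟨g, hg, h0, y, hy, rfl⟩
  obtain h | ⟨g, hg, hg0, y, hy, rfl⟩ := key a ha
  · exact absurd h ha0
  · have := (hirr g (AddSubmonoid.subset_closure hg) y hy rfl).resolve_left hg0
    simpa [this] using hg

end Generators

section PseudoFrobenius

variable {d : ℕ} {S : AddSubmonoid (Fin d → ℕ)}

/-- A finitely generated nonzero affine semigroup has only finitely many pseudo-Frobenius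
elements. -/
theorem finite_PF (hfg : S.FG) (hne : ∃ a ∈ S, a ≠ 0) : (PF S).Finite := by
  obtain ⟨A, rfl⟩ := hfg
  obtain ⟨a, haS, ha0⟩ := hne
  by_contra hinf
  let f := Set.Infinite.natEmbedding (PF (AddSubmonoid.closure (A : Set (Fin d → ℕ)))) hinf
  have hex (n : ℕ) : ∃ c : (Fin d → ℕ) → ℕ, ∑ g ∈ A, c g • g = (f n).1 + a := by
    obtain ⟨c, -, hc⟩ := AddSubmonoid.mem_closure_finset.mp ((f n).2.2 a haS ha0)
    exact ⟨c, hc⟩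
  choose c hc using hex
  -- Dickson's lemma on the coefficient vectors of `f n + a`: the difference `f n - f m` then lies
  -- in the semigroup. It is nonzero, so `f m` being pseudo-Frobenius forces `f n` into the
  -- semigroup.
  obtain ⟨m, n, hmn, hle⟩ := wellQuasiOrdered_le (fun n (g : A) ↦ c n g.1)
  have hsum : (f n).1 = (f m).1 + ∑ g ∈ A, (c n g - c m g) • g := by
    have h : (f n).1 + a = (f m).1 + a + ∑ g ∈ A, (c n g - c m g) • g := by
      rw [← hc, ← hc, ← Finset.sum_add_distrib]
      refine Finset.sum_congr rfl fun g hg ↦ ?_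
      rw [← add_smul, Nat.add_sub_cancel' (hle ⟨g, hg⟩)]
    rw [add_right_comm] at h
    exact add_right_cancel h
  have hmem : ∑ g ∈ A, (c n g - c m g) • g ∈ AddSubmonoid.closure (A : Set (Fin d → ℕ)) :=
    sum_mem fun g hg ↦ nsmul_mem (AddSubmonoid.subset_closure hg) _
  refine (f n).2.1.2 (hsum ▸ (f m).2.2 _ hmem fun h0 ↦ hmn.ne ?_)
  rw [h0, add_zero] at hsum
  exact (f.injective (Subtype.ext hsum)).symm

/-- A semigroup in `ℕ²` that meets both coordinate axes spans the whole quadrant. -/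
lemma mem_cone_of_axes {S : AddSubmonoid (Fin 2 → ℕ)} {c e : ℕ} (hc : c ≠ 0) (he : e ≠ 0)
    (h₁ : ![c, 0] ∈ S) (h₂ : ![0, e] ∈ S) (f : Fin 2 → ℕ) : (fun i ↦ (f i : ℚ)) ∈ cone S := by
  have hf : (fun i ↦ (f i : ℚ)) = (f 0 / c : ℚ≥0) • (fun i ↦ ((![c, 0] : Fin 2 → ℕ) i : ℚ)) +
      (f 1 / e : ℚ≥0) • (fun i ↦ ((![0, e] : Fin 2 → ℕ) i : ℚ)) := by
    ext i
    fin_cases i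
    · simp [NNRat.smul_def, hc]
    · simp [NNRat.smul_def, he]
  rw [hf]
  exact add_mem (Submodule.smul_mem _ _ (Submodule.subset_span ⟨_, h₁, rfl⟩))
    (Submodule.smul_mem _ _ (Submodule.subset_span ⟨_, h₂, rfl⟩))

end PseudoFrobenius

/-! ### The semigroup `S_{a,p}` -/

section Sap

variable {a p : ℕ}

lemma vec_eq_iff {x : Fin 2 → ℕ} {u v : ℕ} : x = ![u, v] ↔ x 0 = u ∧ x 1 = v := by
  constructor
  · rintro rfl
    simp
  · rintro ⟨h₀, h₁⟩
    ext i
    fin_cases i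
    · exact h₀
    · exact h₁

lemma sapGens_subset_sap (a p : ℕ) : sapGens a p ⊆ sap a p := AddSubmonoid.subset_closure

lemma mem_sap_iff {x : Fin 2 → ℕ} :
    x ∈ sap a p ↔ ∃ N α β : ℕ, N ≤ α + β ∧ x = ![2 * N + a * α, 2 * N + a ^ p * β] := by
  constructor
  · intro hx
    induction hx using AddSubmonoid.closure_induction with
    | mem x hx =>
      rcases hx with rfl | rfl | rfl | rfl
      · exact ⟨0, 1, 0, by simp⟩
      · exact ⟨0, 0, 1, by simp⟩
      · exact ⟨1, 1, 0, by simp [add_comm]⟩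
      · exact ⟨1, 0, 1, by simp⟩
    | zero => exact ⟨0, 0, 0, le_rfl, vec_eq_iff.mpr (by simp)⟩
    | add x y _ _ hx hy =>
      obtain ⟨N, α, β, h, rfl⟩ := hx
      obtain ⟨N', α', β', h', rfl⟩ := hy
      refine ⟨N + N', α + α', β + β', by omega, ?_⟩
      rw [vec_eq_iff]
      constructor <;> simp <;> ring
  · rintro ⟨N, α, β, h, rfl⟩
    -- Each of the `N` shifts by `(2, 2)` must be attached to its own copy of `(a, 0)` or `(0, a ^
    -- p)`; the inequality says there are enough copies.
    obtain ⟨i, j, k, l, rfl, rfl, rfl⟩ : ∃ i j k l, α = i + k ∧ β = j + l ∧ N = k + l :=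
      ⟨α - min N α, β - (N - min N α), min N α, N - min N α, by omega, by omega, by omega⟩
    have hx : ![2 * (k + l) + a * (i + k), 2 * (k + l) + a ^ p * (j + l)] =
        i • ![a, 0] + j • ![0, a ^ p] + k • ![a + 2, 2] + l • ![2, 2 + a ^ p] := by
      rw [eq_comm, vec_eq_iff]
      constructor <;> simp <;> ring
    rw [hx]
    have hg := sapGens_subset_sap a p
    refine add_mem (add_mem (add_mem (nsmul_mem (hg ?_) _) (nsmul_mem (hg ?_) _))
      (nsmul_mem (hg ?_) _)) (nsmul_mem (hg ?_) _) <;> simp [sapGens]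

lemma sap_fg (a p : ℕ) : (sap a p).FG :=
  (AddSubmonoid.fg_iff _).mpr ⟨_, rfl, by simp [sapGens]⟩

lemma three_le_pow (ha : 3 ≤ a) (hp : 1 ≤ p) : 3 ≤ a ^ p :=
  ha.trans (Nat.le_self_pow (by omega) a)

/-- Here `A + B` acts as a length. A nonzero element of `S_{a,p}` has length at least one in the
form of `mem_sap_iff`, so a vector whose every representation has length one is irreducible. -/
lemma sum_eq_one_of_mem_sapGens (ha : 3 ≤ a) (hp : 1 ≤ p) {K A B : ℕ}
    (h : ![2 * K + a * A, 2 * K + a ^ p * B] ∈ sapGens a p) : A + B = 1 := by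
  have hq := three_le_pow ha hp
  have hA (h : a * A < a) : A = 0 := by
    by_contra h0
    exact absurd (Nat.le_mul_of_pos_right a (Nat.pos_of_ne_zero h0)) (by omega)
  have hB (h : a ^ p * B < a ^ p) : B = 0 := by
    by_contra h0
    exact absurd (Nat.le_mul_of_pos_right (a ^ p) (Nat.pos_of_ne_zero h0)) (by omega)
  have hA1 (h : a * A = a) : A = 1 := Nat.eq_of_mul_eq_mul_left (by omega : 0 < a) (by omega)
  have hB1 (h : a ^ p * B = a ^ p) : B = 1 :=
    Nat.eq_of_mul_eq_mul_left (by omega : 0 < a ^ p) (by omega)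
  rcases h with h | h | h | h <;> have h0 := congrFun h 0 <;> have h1 := congrFun h 1 <;>
    simp only [Matrix.cons_val_zero, Matrix.cons_val_one] at h0 h1
  · rw [hA1 (by omega), hB (by omega)]
  · rw [hA (by omega), hB1 (by omega)]
  · obtain rfl := hB (by omega)
    rw [hA1 (by omega)]
  · obtain rfl := hA (by omega)
    rw [hB1 (by omega)]

lemma minGens_sap (ha : 3 ≤ a) (hp : 1 ≤ p) : minGens (sap a p) = sapGens a p := by
  refine (minGens_closure_subset _).antisymm fun g hg ↦ ⟨sapGens_subset_sap a p hg, ?_, ?_⟩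
  · have := three_le_pow ha hp
    rcases hg with rfl | rfl | rfl | rfl <;> simp <;> omega
  · intro b hb c hc h
    obtain ⟨N, α, β, hN, rfl⟩ := mem_sap_iff.mp hb
    obtain ⟨N', α', β', hN', rfl⟩ := mem_sap_iff.mp hc
    have hsum : g = ![2 * (N + N') + a * (α + α'), 2 * (N + N') + a ^ p * (β + β')] := by
      rw [h, vec_eq_iff]
      constructor <;> simp <;> ring
    have := sum_eq_one_of_mem_sapGens ha hp (hsum ▸ hg)
    rcases (by omega : α + β = 0 ∨ α' + β' = 0) with h0 | h0
    · left
      obtain ⟨rfl, rfl, rfl⟩ : N = 0 ∧ α = 0 ∧ β = 0 := by omega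
      simp
    · right
      obtain ⟨rfl, rfl, rfl⟩ : N' = 0 ∧ α' = 0 ∧ β' = 0 := by omega
      simp

lemma ncard_sapGens (ha : 3 ≤ a) (hp : 1 ≤ p) : (sapGens a p).ncard = 4 := by
  have := three_le_pow ha hp
  have h₁ : (![a, 0] : Fin 2 → ℕ) ∉ ({![0, a ^ p], ![a + 2, 2], ![2, 2 + a ^ p]} : Set _) := by
    simp
    omega
  have h₂ : (![0, a ^ p] : Fin 2 → ℕ) ∉ ({![a + 2, 2], ![2, 2 + a ^ p]} : Set _) := by
    simp
  have h₃ : (![a + 2, 2] : Fin 2 → ℕ) ∉ ({![2, 2 + a ^ p]} : Set _) := by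
    simp
    omega
  rw [sapGens, Set.ncard_insert_of_notMem h₁, Set.ncard_insert_of_notMem h₂,
    Set.ncard_insert_of_notMem h₃, Set.ncard_singleton]

lemma embDim_sap (ha : 3 ≤ a) (hp : 1 ≤ p) : embDim (sap a p) = 4 := by
  rw [embDim, minGens_sap ha hp, ncard_sapGens ha hp]

lemma diag_mem_sap (a p r : ℕ) : r • ![a, a ^ p] ∈ sap a p :=
  nsmul_mem (mem_sap_iff.mpr ⟨0, 1, 1, by omega, by simp⟩) r

/-- The pseudo-Frobenius elements `(2(q - 1) + aα, 2(q - 1) + qβ)`, `α + β = q - 2`, of `S_{a,p}`,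
where `q = a ^ p`. -/
def sapPF (a p α : ℕ) : Fin 2 → ℕ :=
  ![2 * (a ^ p - 1) + a * α, 2 * (a ^ p - 1) + a ^ p * (a ^ p - 2 - α)]

lemma coprime_pow_two (hodd : Odd a) (p : ℕ) : Nat.Coprime (a ^ p) 2 :=
  Nat.Coprime.pow_left p (Nat.coprime_two_right.mpr hodd)

/-- The second coordinate gives `q ∣ 2 (N + 1)`, hence `N = q - 1 + q t` with `t ≥ 0`. The
coordinates then force `α' ≤ α` and `β' ≤ β`, so `α' + β' ≤ q - 2 < N`. -/
lemma sapPF_notMem (ha : 3 ≤ a) (hodd : Odd a) (hp : 1 ≤ p) {α : ℕ} (hα : α < a ^ p - 1) :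
    sapPF a p α ∉ sap a p := by
  intro h
  obtain ⟨N, α', β', hN, h⟩ := mem_sap_iff.mp h
  have h0 := congrFun h 0
  have h1 := congrFun h 1
  simp only [sapPF, Matrix.cons_val_zero, Matrix.cons_val_one] at h0 h1
  have hq := three_le_pow ha hp
  have hcop := coprime_pow_two hodd p
  obtain ⟨q', hq'⟩ : a ∣ a ^ p := dvd_pow_self a (by omega)
  generalize a ^ p = q at *
  obtain ⟨β, hβ⟩ : ∃ β, q - 2 - α = β := ⟨_, rfl⟩
  rw [hβ] at h1
  have hdvd : q ∣ N + 1 := by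
    refine hcop.dvd_of_dvd_mul_left ?_
    refine (Nat.dvd_add_right (dvd_mul_right q β')).mp ?_
    exact ⟨β + 2, by rw [mul_add q β 2]; omega⟩
  obtain ⟨j, hj⟩ := hdvd
  obtain ⟨t, rfl⟩ : ∃ t, j = t + 1 := Nat.exists_eq_succ_of_ne_zero (by rintro rfl; omega)
  have hN' : N = q - 1 + q * t := by
    rw [mul_add] at hj
    omega
  have hα' : α = α' + 2 * q' * t := by
    refine Nat.eq_of_mul_eq_mul_left (by omega : 0 < a) ?_
    have : a * (α' + 2 * q' * t) = a * α' + 2 * ((a * q') * t) := by ring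
    rw [this, ← hq']
    omega
  have hβ' : β = β' + 2 * t := by
    refine Nat.eq_of_mul_eq_mul_left (by omega : 0 < q) ?_
    have : q * (β' + 2 * t) = q * β' + 2 * (q * t) := by ring
    omega
  have : α' ≤ α := by omega
  omega

lemma sapPF_add_mem (ha : 3 ≤ a) (hp : 1 ≤ p) {α : ℕ} (hα : α < a ^ p - 1)
    {s : Fin 2 → ℕ} (hs : s ∈ sap a p) (hs0 : s ≠ 0) : sapPF a p α + s ∈ sap a p := by
  obtain ⟨N, α', β', hN, rfl⟩ := mem_sap_iff.mp hs
  have hq := three_le_pow ha hp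
  obtain ⟨q', hq'⟩ : a ∣ a ^ p := dvd_pow_self a (by omega)
  have hpos : 0 < α' + β' := by
    by_contra h0
    obtain ⟨rfl, rfl, rfl⟩ : N = 0 ∧ α' = 0 ∧ β' = 0 := by omega
    simp at hs0
  rw [mem_sap_iff]
  unfold sapPF
  generalize a ^ p = q at *
  -- If `N = 0`, the extra `α' + β' ≥ 1` closes the gap of one. Otherwise the total shift count
  -- reaches `q`, and `q` shifts by `(2, 2)` equal `2 q'` copies of `(a, 0)` plus two of `(0, q)`,
  -- where `q = a q'`.
  rcases Nat.eq_zero_or_pos N with rfl | hNpos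
  · refine ⟨q - 1, α + α', q - 2 - α + β', by omega, ?_⟩
    rw [vec_eq_iff]
    constructor <;> simp <;> ring
  · refine ⟨N - 1, α + α' + 2 * q', q - 2 - α + β' + 2, by omega, ?_⟩
    rw [vec_eq_iff]
    obtain ⟨M, rfl⟩ : ∃ M, N = M + 1 := ⟨N - 1, by omega⟩
    have h2 : 2 * (q - 1) + 2 = 2 * q := by omega
    constructor
    · simp only [Pi.add_apply, Matrix.cons_val_zero, add_tsub_cancel_right]
      linear_combination h2 + 2 * hq'
    · simp only [Pi.add_apply, Matrix.cons_val_one, Matrix.cons_val_fin_one, add_tsub_cancel_right]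
      linear_combination h2

lemma sapPF_mem_PF (ha : 3 ≤ a) (hodd : Odd a) (hp : 1 ≤ p) {α : ℕ} (hα : α < a ^ p - 1) :
    sapPF a p α ∈ PF (sap a p) := by
  have hq := three_le_pow ha hp
  refine ⟨⟨?_, sapPF_notMem ha hodd hp hα⟩, fun s hs hs0 ↦ sapPF_add_mem ha hp hα hs hs0⟩
  exact mem_cone_of_axes (c := a) (e := a ^ p) (by omega) (by omega)
    (sapGens_subset_sap a p (by simp [sapGens])) (sapGens_subset_sap a p (by simp [sapGens])) _

lemma sapPF_injective (ha : 3 ≤ a) : Function.Injective (sapPF a p) := by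
  intro α α' h
  have h0 := congrFun h 0
  simp only [sapPF, Matrix.cons_val_zero] at h0
  exact Nat.eq_of_mul_eq_mul_left (by omega : 0 < a) (by omega)

lemma finite_PF_sap (ha : 3 ≤ a) : (PF (sap a p)).Finite :=
  finite_PF (sap_fg a p) ⟨![a, 0], sapGens_subset_sap a p (by simp [sapGens]), by
    simp
    omega⟩

lemma le_bettiType_sap (ha : 3 ≤ a) (hodd : Odd a) (hp : 1 ≤ p) :
    a ^ p - 1 ≤ bettiType (sap a p) := by
  have hsub : sapPF a p '' Set.Iio (a ^ p - 1) ⊆ PF (sap a p) := by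
    rintro _ ⟨α, hα, rfl⟩
    exact sapPF_mem_PF ha hodd hp hα
  refine le_trans (le_of_eq ?_) (Set.ncard_le_ncard hsub (finite_PF_sap ha))
  rw [Set.ncard_image_of_injective _ (sapPF_injective ha), Set.ncard_eq_toFinset_card']
  simp

theorem isMPD_sap (k : Type u) [Field k] (ha : 3 ≤ a) (hodd : Odd a) (hp : 1 ≤ p) :
    IsMPD k (sap a p) := by
  have hq := three_le_pow ha hp
  refine isMPD_of_PF_nonempty (sap_fg a p) ?_ ?_ ⟨_, sapPF_mem_PF ha hodd hp (α := 0) (by omega)⟩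
  · rw [minGens_sap ha hp]
    simp [sapGens]
  · rw [minGens_sap ha hp]
    exact ⟨![a, 0], by simp [sapGens]⟩

end Sap
end AffineSemigroup

namespace AffineSemigroup

/-! ### Gluing `S_{a,p}` with a numerical semigroup along the diagonal -/

section Glued

variable {a p m : ℕ}

/-- A multiple `t (a, a ^ p)` that lies in the `m`-fold of the group of `S_{a,p}` is a multiple of
`m (a, a ^ p)`. -/
lemma dvd_of_mul_eq (ha : 3 ≤ a) (hodd : Odd a) (hp : 1 ≤ p) (h : 2 ≤ p ∨ Nat.Coprime a m)
    {N α β t : ℤ} (h₁ : m * (2 * N + a * α) = t * a)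
    (h₂ : m * (2 * N + (a : ℤ) ^ p * β) = t * (a : ℤ) ^ p) : (m : ℤ) ∣ t := by
  have ha0 : (a : ℤ) ≠ 0 := by positivity
  rcases Nat.eq_zero_or_pos m with rfl | hm
  · simp only [Nat.cast_zero, zero_mul, zero_eq_mul, ha0, or_false] at h₁
    simp [h₁]
  have hm0 : (m : ℤ) ≠ 0 := by positivity
  have hcop2 : IsCoprime (a : ℤ) 2 := by
    exact_mod_cast Nat.isCoprime_iff_coprime.mpr (Nat.coprime_two_right.mpr hodd)
  have hN : (a : ℤ) ∣ N := by
    rcases h with hp2 | hcop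
    · obtain ⟨r, rfl⟩ : ∃ r, p = r + 2 := ⟨p - 2, by omega⟩
      -- Elimination of `t`. The factor `a ^ (p - 1) - 1` is prime to `a` because `p ≥ 2`; for `p =
      -- 1` it is zero, and coprimality of `a` and `m` takes over.
      have h₃ : 2 * N * ((a : ℤ) ^ (r + 1) - 1) = a * (a ^ (r + 1) * (β - α)) := by
        refine mul_left_cancel₀ hm0 ?_
        linear_combination (a : ℤ) ^ (r + 1) * h₁ - h₂
      have hcop' : IsCoprime (a : ℤ) ((a : ℤ) ^ (r + 1) - 1) :=
        ⟨a ^ r, -1, by ring⟩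
      exact hcop2.dvd_of_dvd_mul_left (hcop'.dvd_of_dvd_mul_right ⟨_, h₃⟩)
    · have hcop' : IsCoprime (a : ℤ) m := Nat.isCoprime_iff_coprime.mpr hcop
      refine hcop2.dvd_of_dvd_mul_left (hcop'.dvd_of_dvd_mul_left ⟨t - m * α, ?_⟩)
      linear_combination h₁
  obtain ⟨N', rfl⟩ := hN
  refine ⟨2 * N' + α, mul_right_cancel₀ ha0 ?_⟩
  linear_combination -h₁

/-- The relations between the multiples of elements of the group of `S_{a,p}` and the multiples of
`(a, a ^ p)`. -/
lemma exchange_of_le (ha : 3 ≤ a) (hodd : Odd a) (hp : 1 ≤ p) (hm : 1 ≤ m)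
    (h : 2 ≤ p ∨ Nat.Coprime a m) {N α β N' α' β' t t' : ℕ}
    (heq : m • ![2 * N + a * α, 2 * N + a ^ p * β] + t • ![a, a ^ p] =
      m • ![2 * N' + a * α', 2 * N' + a ^ p * β'] + t' • ![a, a ^ p]) (hle : t ≤ t') :
    ∃ r, t' = t + m * r ∧ ![2 * N + a * α, 2 * N + a ^ p * β] =
      ![2 * N' + a * α', 2 * N' + a ^ p * β'] + r • ![a, a ^ p] := by
  have h0 := congrFun heq 0
  have h1 := congrFun heq 1
  simp only [Pi.add_apply, Pi.smul_apply, smul_eq_mul, Matrix.cons_val_zero, Matrix.cons_val_one,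
    Matrix.cons_val_fin_one] at h0 h1
  zify at h0 h1
  have hdvd : (m : ℤ) ∣ t' - t := by
    refine dvd_of_mul_eq ha hodd hp h (N := N - N') (α := α - α') (β := β - β') ?_ ?_
    · linear_combination h0
    · linear_combination h1
  obtain ⟨r, hr⟩ : m ∣ t' - t := by
    rw [← Nat.cast_sub hle] at hdvd
    exact_mod_cast hdvd
  obtain rfl : t' = t + m * r := by omega
  refine ⟨r, rfl, ?_⟩
  refine nsmul_right_injective (by omega : m ≠ 0) (add_right_cancel (b := t • ![a, a ^ p]) ?_)
  simp only [heq, smul_add, add_smul, mul_smul]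
  abel

/-- Near-uniqueness of the expressions `m v + t δ`, used for minimality, disjointness and
non-membership. Only a representation of `s` is required, not membership in `S_{a,p}`, so it also
applies to the elements `sapPF`. -/
lemma exchange (ha : 3 ≤ a) (hodd : Odd a) (hp : 1 ≤ p) (hm : 1 ≤ m)
    (h : 2 ≤ p ∨ Nat.Coprime a m) {N α β t t' : ℕ} {s s' : Fin 2 → ℕ}
    (hs : s = ![2 * N + a * α, 2 * N + a ^ p * β]) (hs' : s' ∈ sap a p)
    (heq : m • s + t • ![a, a ^ p] = m • s' + t' • ![a, a ^ p]) :
    (∃ r, t' = t + m * r ∧ s = s' + r • ![a, a ^ p]) ∨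
      ∃ r, t = t' + m * r ∧ s' = s + r • ![a, a ^ p] := by
  obtain ⟨N', α', β', -, rfl⟩ := mem_sap_iff.mp hs'
  subst hs
  rcases le_total t t' with hle | hle
  · exact .inl (exchange_of_le ha hodd hp hm h heq hle)
  · exact .inr (exchange_of_le ha hodd hp hm h heq.symm hle)

variable {s : ℕ} {n : Fin s → ℕ}

lemma closure_scaledSapGens (a p m : ℕ) : AddSubmonoid.closure (scaledSapGens a p m) =
    (sap a p).map (nsmulAddMonoidHom m) :=
  (AddMonoidHom.map_mclosure (nsmulAddMonoidHom m) (sapGens a p)).symm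

lemma closure_scaledNumGens (a p : ℕ) (n : Fin s → ℕ) :
    AddSubmonoid.closure (scaledNumGens a p n) =
      (AddSubmonoid.closure (Set.range n)).map (multiplesHom _ ![a, a ^ p]) := by
  rw [AddMonoidHom.map_mclosure, ← Set.range_comp]
  rfl

lemma mem_glued_iff {x : Fin 2 → ℕ} : x ∈ glued a p m n ↔
    ∃ v ∈ sap a p, ∃ t ∈ AddSubmonoid.closure (Set.range n), x = m • v + t • ![a, a ^ p] := by
  rw [glued, AddSubmonoid.closure_union, closure_scaledSapGens, closure_scaledNumGens,
    AddSubmonoid.mem_sup]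
  constructor
  · rintro ⟨_, ⟨v, hv, rfl⟩, _, ⟨t, ht, rfl⟩, rfl⟩
    exact ⟨v, hv, t, ht, rfl⟩
  · rintro ⟨v, hv, t, ht, rfl⟩
    exact ⟨_, ⟨v, hv, rfl⟩, _, ⟨t, ht, rfl⟩, rfl⟩

lemma finite_scaledSapGens (a p m : ℕ) : (scaledSapGens a p m).Finite := by
  simp [scaledSapGens, sapGens, Set.image_insert_eq]

lemma finite_scaledNumGens (a p : ℕ) (n : Fin s → ℕ) : (scaledNumGens a p n).Finite :=
  Set.finite_range _

lemma glued_fg (a p m : ℕ) (n : Fin s → ℕ) : (glued a p m n).FG :=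
  (AddSubmonoid.fg_iff _).mpr
    ⟨_, rfl, (finite_scaledSapGens a p m).union (finite_scaledNumGens a p n)⟩

lemma diag_ne_zero (ha : 3 ≤ a) : (![a, a ^ p] : Fin 2 → ℕ) ≠ 0 := by
  intro h
  have := congrFun h 0
  simp only [Matrix.cons_val_zero, Pi.zero_apply] at this
  omega

lemma nsmul_diag_eq_zero (ha : 3 ≤ a) {r : ℕ} (h : r • (![a, a ^ p] : Fin 2 → ℕ) = 0) : r = 0 :=
  (smul_eq_zero.mp h).resolve_right (diag_ne_zero ha)

lemma nsmul_diag_injective (ha : 3 ≤ a) :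
    Function.Injective fun r : ℕ ↦ r • (![a, a ^ p] : Fin 2 → ℕ) := by
  intro r r' h
  have := congrFun h 0
  simp only [Pi.smul_apply, Matrix.cons_val_zero, smul_eq_mul] at this
  exact Nat.eq_of_mul_eq_mul_right (by omega : 0 < a) this

lemma exists_rep_of_mem_sap {v : Fin 2 → ℕ} (hv : v ∈ sap a p) :
    ∃ N α β : ℕ, v = ![2 * N + a * α, 2 * N + a ^ p * β] := by
  obtain ⟨N, α, β, -, h⟩ := mem_sap_iff.mp hv
  exact ⟨N, α, β, h⟩

lemma minGens_glued (ha : 3 ≤ a) (hodd : Odd a) (hp : 1 ≤ p) (h : 2 ≤ p ∨ Nat.Coprime a m)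
    (hn : minGens (AddSubmonoid.closure (Set.range n)) = Set.range n) (hm : 1 ≤ m)
    (hlt : ∀ i, n i < m) :
    minGens (glued a p m n) = scaledSapGens a p m ∪ scaledNumGens a p n := by
  refine (minGens_closure_subset _).antisymm ?_
  rintro x (⟨g, hg, rfl⟩ | ⟨i, rfl⟩)
  · have hg' : g ∈ minGens (sap a p) := minGens_sap ha hp ▸ hg
    obtain ⟨hgS, hg0, hirr⟩ := hg'
    refine ⟨AddSubmonoid.subset_closure (.inl ⟨g, hg, rfl⟩),
      fun h0 ↦ hg0 ((smul_eq_zero.mp h0).resolve_left (by omega)), ?_⟩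
    intro b hb c hc hbc
    obtain ⟨v, hv, t, -, rfl⟩ := mem_glued_iff.mp hb
    obtain ⟨v', hv', t', -, rfl⟩ := mem_glued_iff.mp hc
    obtain ⟨N, α, β, hrep⟩ := exists_rep_of_mem_sap hgS
    have key : t + t' = 0 ∧ g = v + v' := by
      obtain ⟨r, hr, hgr⟩ | ⟨r, hr, hgr⟩ := exchange ha hodd hp hm h (t := 0) (t' := t + t') hrep
        (add_mem hv hv') (by
          change m • g = _ at hbc
          rw [hbc]
          simp only [smul_add, add_smul, zero_smul, add_zero]
          abel)
      -- Here `g = (v + v') + r δ` with `g` irreducible. The case `g = r δ` is excluded for `r ≠ 0`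
      -- by splitting `δ` along the two axes.
      · have hr0 : r = 0 := by
          rcases hirr _ (add_mem hv hv') _ (diag_mem_sap a p r) hgr with h0 | h0
          · rw [h0, zero_add] at hgr
            have hsum : g = ![r * a, 0] + ![0, r * a ^ p] := by
              rw [hgr, eq_comm]
              ext j
              fin_cases j <;> simp
            have h₁ : ![r * a, 0] ∈ sap a p :=
              mem_sap_iff.mpr ⟨0, r, 0, by omega, by simp [mul_comm]⟩
            have h₂ : ![0, r * a ^ p] ∈ sap a p :=
              mem_sap_iff.mpr ⟨0, 0, r, by omega, by simp [mul_comm]⟩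
            have hq := three_le_pow ha hp
            rcases hirr _ h₁ _ h₂ hsum with h0 | h0
            · have := congrFun h0 0
              simp only [Matrix.cons_val_zero, Pi.zero_apply, mul_eq_zero] at this
              omega
            · have := congrFun h0 1
              simp only [Matrix.cons_val_one, Matrix.cons_val_fin_one, Pi.zero_apply,
                mul_eq_zero] at this
              omega
          · exact nsmul_diag_eq_zero ha h0
        subst hr0
        exact ⟨by simpa using hr, by simpa using hgr⟩
      · have h0 : t + t' = 0 ∧ m * r = 0 := by omega
        have hr0 : r = 0 := (mul_eq_zero.mp h0.2).resolve_left (by omega)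
        subst hr0
        exact ⟨h0.1, by simpa using hgr.symm⟩
    obtain ⟨rfl, rfl⟩ : t = 0 ∧ t' = 0 := by omega
    rcases hirr v hv v' hv' key.2 with rfl | rfl
    · left; simp
    · right; simp
  · have hi : n i ∈ minGens (AddSubmonoid.closure (Set.range n)) := by
      rw [hn]
      exact ⟨i, rfl⟩
    obtain ⟨-, hi0, hirr⟩ := hi
    refine ⟨AddSubmonoid.subset_closure (.inr ⟨i, rfl⟩),
      fun h0 ↦ hi0 (nsmul_diag_eq_zero ha h0), ?_⟩
    intro b hb c hc hbc
    obtain ⟨v, hv, t, ht, rfl⟩ := mem_glued_iff.mp hb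
    obtain ⟨v', hv', t', ht', rfl⟩ := mem_glued_iff.mp hc
    have key : n i = t + t' ∧ v + v' = 0 := by
      obtain ⟨N, α, β, hrep⟩ := exists_rep_of_mem_sap (zero_mem (sap a p))
      obtain ⟨r, hr, hgr⟩ | ⟨r, hr, hgr⟩ := exchange ha hodd hp hm h (t := n i) (t' := t + t') hrep
        (add_mem hv hv') (by
          change n i • _ = _ at hbc
          rw [hbc]
          simp only [smul_add, add_smul, smul_zero, zero_add]
          abel)
      · obtain ⟨h₁, h₂⟩ := add_eq_zero.mp hgr.symm
        have := nsmul_diag_eq_zero ha h₂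
        subst this
        exact ⟨by simpa using hr.symm, h₁⟩
      -- Now `n i = t + t' + m r`, so `n i < m` leaves no room for `r ≥ 1`.
      · have hr0 : r = 0 := by
          by_contra hr0
          have := Nat.le_mul_of_pos_right m (Nat.pos_of_ne_zero hr0)
          have := hlt i
          omega
        subst hr0
        exact ⟨by simpa using hr, by simpa using hgr⟩
    obtain ⟨rfl, rfl⟩ := add_eq_zero.mp key.2
    rcases hirr t ht t' ht' key.1 with rfl | rfl
    · left; simp
    · right; simp

lemma disjoint_scaledGens (ha : 3 ≤ a) (hodd : Odd a) (hp : 1 ≤ p) (h : 2 ≤ p ∨ Nat.Coprime a m)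
    (hm : 1 ≤ m) (hlt : ∀ i, n i < m) :
    Disjoint (scaledSapGens a p m) (scaledNumGens a p n) := by
  rw [Set.disjoint_left]
  rintro _ ⟨g, hg, rfl⟩ ⟨i, hi⟩
  have hg' : g ∈ minGens (sap a p) := minGens_sap ha hp ▸ hg
  obtain ⟨N, α, β, hrep⟩ := exists_rep_of_mem_sap hg'.1
  obtain ⟨r, hr, hgr⟩ | ⟨r, hr, hgr⟩ := exchange ha hodd hp hm h (t := 0) (t' := n i) hrep
    (zero_mem (sap a p)) (by simpa using hi.symm)
  · have hr0 : r = 0 := by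
      by_contra hr0
      have := Nat.le_mul_of_pos_right m (Nat.pos_of_ne_zero hr0)
      have := hlt i
      omega
    exact hg'.2.1 (by simpa [hr0] using hgr)
  · exact hg'.2.1 (add_eq_zero.mp hgr.symm).1

lemma embDim_glued (ha : 3 ≤ a) (hodd : Odd a) (hp : 1 ≤ p) (h : 2 ≤ p ∨ Nat.Coprime a m)
    (hinj : Function.Injective n)
    (hn : minGens (AddSubmonoid.closure (Set.range n)) = Set.range n) (hm : 1 ≤ m)
    (hlt : ∀ i, n i < m) : embDim (glued a p m n) = s + 4 := by
  rw [embDim, minGens_glued ha hodd hp h hn hm hlt,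
    Set.ncard_union_eq (disjoint_scaledGens ha hodd hp h hm hlt) (finite_scaledSapGens a p m)
      (finite_scaledNumGens a p n), scaledSapGens,
    Set.ncard_image_of_injective _ (nsmul_right_injective (by omega : m ≠ 0)),
    ncard_sapGens ha hp, scaledNumGens, ← Set.image_univ,
    Set.ncard_image_of_injective (f := fun i ↦ n i • ![a, a ^ p]) _
      ((nsmul_diag_injective ha).comp hinj), Set.ncard_univ, Nat.card_fin, add_comm]

/-- In the group the inequality `N ≤ α + β` disappears. Only this inclusion is needed for the upper
bound on the intersection of the two groups. -/
lemma groupOf_closure_scaledSapGens {x : Fin 2 → ℤ}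
    (hx : x ∈ groupOf (AddSubmonoid.closure (scaledSapGens a p m))) :
    ∃ N α β : ℤ, x 0 = m * (2 * N + a * α) ∧ x 1 = m * (2 * N + (a : ℤ) ^ p * β) := by
  induction hx using AddSubgroup.closure_induction with
  | mem x hx =>
    obtain ⟨y, hy, rfl⟩ := hx
    rw [SetLike.mem_coe, closure_scaledSapGens] at hy
    obtain ⟨v, hv, rfl⟩ := hy
    obtain ⟨N, α, β, rfl⟩ := exists_rep_of_mem_sap hv
    exact ⟨N, α, β, by simp, by simp⟩
  | zero => exact ⟨0, 0, 0, by simp, by simp⟩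
  | add x y _ _ hx hy =>
    obtain ⟨N, α, β, h0, h1⟩ := hx
    obtain ⟨N', α', β', h0', h1'⟩ := hy
    refine ⟨N + N', α + α', β + β', ?_, ?_⟩
    · rw [Pi.add_apply, h0, h0']; ring
    · rw [Pi.add_apply, h1, h1']; ring
  | neg x _ hx =>
    obtain ⟨N, α, β, h0, h1⟩ := hx
    refine ⟨-N, -α, -β, ?_, ?_⟩
    · rw [Pi.neg_apply, h0]; ring
    · rw [Pi.neg_apply, h1]; ring

lemma groupOf_closure_scaledNumGens {x : Fin 2 → ℤ}
    (hx : x ∈ groupOf (AddSubmonoid.closure (scaledNumGens a p n))) :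
    ∃ t : ℤ, x 0 = t * a ∧ x 1 = t * (a : ℤ) ^ p := by
  induction hx using AddSubgroup.closure_induction with
  | mem x hx =>
    obtain ⟨y, hy, rfl⟩ := hx
    rw [SetLike.mem_coe, closure_scaledNumGens] at hy
    obtain ⟨t, ht, rfl⟩ := hy
    exact ⟨t, by simp, by simp⟩
  | zero => exact ⟨0, by simp, by simp⟩
  | add x y _ _ hx hy =>
    obtain ⟨t, h0, h1⟩ := hx
    obtain ⟨t', h0', h1'⟩ := hy
    exact ⟨t + t', by rw [Pi.add_apply, h0, h0']; ring, by rw [Pi.add_apply, h1, h1']; ring⟩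
  | neg x _ hx =>
    obtain ⟨t, h0, h1⟩ := hx
    exact ⟨-t, by rw [Pi.neg_apply, h0]; ring, by rw [Pi.neg_apply, h1]; ring⟩

theorem isSapGluing (ha : 3 ≤ a) (hodd : Odd a) (hp : 1 ≤ p) (h : 2 ≤ p ∨ Nat.Coprime a m)
    (hs : s ≠ 0) (hn : minGens (AddSubmonoid.closure (Set.range n)) = Set.range n) (hm : 1 ≤ m)
    (hmT : m ∈ AddSubmonoid.closure (Set.range n)) (hlt : ∀ i, n i < m) :
    IsSapGluing a p m n := by
  have h₁ : m • ![a, a ^ p] ∈ AddSubmonoid.closure (scaledSapGens a p m) := by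
    rw [closure_scaledSapGens]
    exact ⟨![a, a ^ p], by simpa using diag_mem_sap a p 1, rfl⟩
  have h₂ : m • ![a, a ^ p] ∈ AddSubmonoid.closure (scaledNumGens a p n) := by
    rw [closure_scaledNumGens]
    exact ⟨m, hmT, rfl⟩
  refine ⟨glued_fg a p m n, ⟨scaledSapGens a p m, scaledNumGens a p n,
    ⟨m • ![a, 0], ![a, 0], by simp [sapGens], rfl⟩,
    ⟨_, ⟨0, Nat.pos_of_ne_zero hs⟩, rfl⟩, disjoint_scaledGens ha hodd hp h hm hlt,
    (minGens_glued ha hodd hp h hn hm hlt).symm, rfl, rfl⟩, h₁, h₂, le_antisymm ?_ ?_⟩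
  · rintro x ⟨hx₁, hx₂⟩
    obtain ⟨N, α, β, h0, h1⟩ := groupOf_closure_scaledSapGens hx₁
    obtain ⟨t, h0', h1'⟩ := groupOf_closure_scaledNumGens hx₂
    obtain ⟨r, rfl⟩ := dvd_of_mul_eq ha hodd hp h (h0.symm.trans h0') (h1.symm.trans h1')
    rw [AddSubgroup.mem_zmultiples_iff]
    refine ⟨r, funext fun i ↦ ?_⟩
    fin_cases i
    · simp [h0']; ring
    · simp [h1']; ring
  · rw [AddSubgroup.zmultiples_le]
    exact ⟨AddSubgroup.subset_closure ⟨_, h₁, rfl⟩, AddSubgroup.subset_closure ⟨_, h₂, rfl⟩⟩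

lemma finite_PF_glued (ha : 3 ≤ a) (hm : 1 ≤ m) : (PF (glued a p m n)).Finite := by
  refine finite_PF (glued_fg a p m n)
    ⟨m • ![a, 0], AddSubmonoid.subset_closure (.inl ⟨_, by simp [sapGens], rfl⟩), fun h ↦ ?_⟩
  have := congrFun h 0
  simp at this
  omega

/-- Pseudo-Frobenius elements of the gluing. The conditions on `H` say that `H - m` is a
pseudo-Frobenius number of the numerical semigroup. -/
lemma add_mem_PF_glued (ha : 3 ≤ a) (hodd : Odd a) (hp : 1 ≤ p) (h : 2 ≤ p ∨ Nat.Coprime a m)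
    (hm : 1 ≤ m) (hmT : m ∈ AddSubmonoid.closure (Set.range n)) {H α : ℕ}
    (hHT : H ∈ AddSubmonoid.closure (Set.range n))
    (hH : ∀ t ∈ AddSubmonoid.closure (Set.range n), H ≠ m + t)
    (hH' : ∀ t ∈ AddSubmonoid.closure (Set.range n), t ≠ 0 →
      ∃ t' ∈ AddSubmonoid.closure (Set.range n), H + t = m + t') (hα : α < a ^ p - 1) :
    m • sapPF a p α + H • ![a, a ^ p] ∈ PF (glued a p m n) := by
  have hq := three_le_pow ha hp
  refine ⟨⟨?_, ?_⟩, ?_⟩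
  · refine mem_cone_of_axes (c := m * a) (e := m * a ^ p) (by positivity) (by positivity)
      (AddSubmonoid.subset_closure (.inl ⟨![a, 0], by simp [sapGens], ?_⟩))
      (AddSubmonoid.subset_closure (.inl ⟨![0, a ^ p], by simp [sapGens], ?_⟩)) _ <;> simp
  · intro hmem
    obtain ⟨v, hv, t, ht, heq⟩ := mem_glued_iff.mp hmem
    obtain ⟨r, hr, hgr⟩ | ⟨r, hr, hgr⟩ := exchange ha hodd hp hm h (s := sapPF a p α) rfl hv heq
    · exact sapPF_notMem ha hodd hp hα (hgr ▸ add_mem hv (diag_mem_sap a p r))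
    · rcases r with _ | r
      · exact sapPF_notMem ha hodd hp hα (by simpa [hgr] using hv)
      -- At least one full `m` was moved out of `H`, so `H - m` would lie in the numerical
      -- semigroup.
      · refine hH (t + r • m) (add_mem ht (nsmul_mem hmT r)) ?_
        rw [hr, smul_eq_mul]
        ring
  · intro x hx hx0
    obtain ⟨v, hv, t, ht, rfl⟩ := mem_glued_iff.mp hx
    -- When `v = 0`, writing `H + t = m + t'` releases one `m δ`, which moves the first summand from
    -- `sapPF` to `sapPF + δ`, an element of `S_{a,p}`. When `v ≠ 0`, `sapPF + v` already lies
    -- there.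
    by_cases hv0 : v = 0
    · subst hv0
      have ht0 : t ≠ 0 := by
        rintro rfl
        simp at hx0
      obtain ⟨t', ht', heq⟩ := hH' t ht ht0
      refine mem_glued_iff.mpr ⟨_, sapPF_add_mem ha hp hα (by simpa using diag_mem_sap a p 1)
        (diag_ne_zero ha), t', ht', ?_⟩
      rw [smul_zero, zero_add, add_assoc, ← add_smul, heq, add_smul, smul_add, add_assoc]
    · refine mem_glued_iff.mpr ⟨_, sapPF_add_mem ha hp hα hv hv0, H + t, add_mem hHT ht, ?_⟩
      rw [smul_add, add_smul]
      abel

/-- The coordinates determine `m α + H` and `m β + H`, hence `α - β`. As `β = q - 2 - α` is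
nonincreasing in `α`, this fixes `α`, and then `H`. -/
lemma add_smul_diag_injective (ha : 3 ≤ a) (hp : 1 ≤ p) (hm : 1 ≤ m) {H H' α α' : ℕ}
    (heq : m • sapPF a p α + H • ![a, a ^ p] = m • sapPF a p α' + H' • ![a, a ^ p]) :
    H = H' ∧ α = α' := by
  have h0 := congrFun heq 0
  have h1 := congrFun heq 1
  simp only [sapPF, Pi.add_apply, Pi.smul_apply, smul_eq_mul, Matrix.cons_val_zero,
    Matrix.cons_val_one, Matrix.cons_val_fin_one] at h0 h1
  have hq := three_le_pow ha hp
  generalize a ^ p = q at *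
  obtain ⟨β, hβ⟩ : ∃ β, q - 2 - α = β := ⟨_, rfl⟩
  obtain ⟨β', hβ'⟩ : ∃ β, q - 2 - α' = β := ⟨_, rfl⟩
  rw [hβ, hβ'] at h1
  have e0 : m * α + H = m * α' + H' :=
    Nat.eq_of_mul_eq_mul_left (by omega : 0 < a) (by linarith)
  have e1 : m * β + H = m * β' + H' :=
    Nat.eq_of_mul_eq_mul_left (by omega : 0 < q) (by linarith)
  have e2 : m * (α + β') = m * (α' + β) := by linarith
  have e3 := Nat.eq_of_mul_eq_mul_left (by omega : 0 < m) e2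
  obtain rfl : α = α' := by omega
  exact ⟨by omega, rfl⟩

lemma mul_le_bettiType_glued (ha : 3 ≤ a) (hodd : Odd a) (hp : 1 ≤ p)
    (h : 2 ≤ p ∨ Nat.Coprime a m) (hm : 1 ≤ m) (hmT : m ∈ AddSubmonoid.closure (Set.range n))
    {A : Set ℕ} (hA : ∀ H ∈ A, H ∈ AddSubmonoid.closure (Set.range n) ∧
      (∀ t ∈ AddSubmonoid.closure (Set.range n), H ≠ m + t) ∧
      ∀ t ∈ AddSubmonoid.closure (Set.range n), t ≠ 0 →
        ∃ t' ∈ AddSubmonoid.closure (Set.range n), H + t = m + t') :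
    A.ncard * (a ^ p - 1) ≤ bettiType (glued a p m n) := by
  let φ : ℕ × ℕ → (Fin 2 → ℕ) := fun x ↦ m • sapPF a p x.2 + x.1 • ![a, a ^ p]
  have hsub : φ '' (A ×ˢ Set.Iio (a ^ p - 1)) ⊆ PF (glued a p m n) := by
    rintro _ ⟨⟨H, α⟩, ⟨hH, hα⟩, rfl⟩
    obtain ⟨h₁, h₂, h₃⟩ := hA H hH
    exact add_mem_PF_glued ha hodd hp h hm hmT h₁ h₂ h₃ hα
  have hinj : Set.InjOn φ (A ×ˢ Set.Iio (a ^ p - 1)) := by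
    rintro ⟨H, α⟩ - ⟨H', α'⟩ - heq
    obtain ⟨rfl, rfl⟩ := add_smul_diag_injective ha hp hm heq
    rfl
  refine le_trans (le_of_eq ?_) (Set.ncard_le_ncard hsub (finite_PF_glued ha hm))
  rw [hinj.ncard_image, Set.ncard_prod, Set.ncard_eq_toFinset_card' (Set.Iio _)]
  simp

theorem isMPD_glued (k : Type u) [Field k] (ha : 3 ≤ a) (hodd : Odd a) (hp : 1 ≤ p)
    (h : 2 ≤ p ∨ Nat.Coprime a m)
    (hn : minGens (AddSubmonoid.closure (Set.range n)) = Set.range n) (hm : 1 ≤ m)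
    (hlt : ∀ i, n i < m) (hPF : 0 < bettiType (glued a p m n)) : IsMPD k (glued a p m n) := by
  refine isMPD_of_PF_nonempty (glued_fg a p m n) ?_ ?_ (Set.nonempty_of_ncard_ne_zero hPF.ne')
  · rw [minGens_glued ha hodd hp h hn hm hlt]
    exact (finite_scaledSapGens a p m).union (finite_scaledNumGens a p n)
  · rw [minGens_glued ha hodd hp h hn hm hlt]
    exact ⟨_, .inl ⟨![a, 0], by simp [sapGens], rfl⟩⟩

end Glued
end AffineSemigroup

namespace AffineSemigroup

/-! ### Numerical semigroups -/

section Numerical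

variable {s : ℕ} {n : Fin s → ℕ}

lemma minGens_closure_range_one :
    minGens (AddSubmonoid.closure (Set.range (![1] : Fin 1 → ℕ))) = Set.range (![1] : Fin 1 → ℕ) := by
  refine (minGens_closure_subset _).antisymm ?_
  rintro _ ⟨i, rfl⟩
  obtain rfl : i = 0 := Subsingleton.elim _ _
  refine ⟨AddSubmonoid.subset_closure ⟨0, rfl⟩, by simp, fun b _ c _ h ↦ ?_⟩
  simp only [Matrix.cons_val_fin_one] at h
  omega

lemma IsNumericalGenerators.pos (hn : IsNumericalGenerators n) (i : Fin s) : 0 < n i := by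
  have : n i ∈ minGens (AddSubmonoid.closure (Set.range n)) := by
    rw [hn.2.1]
    exact ⟨i, rfl⟩
  exact Nat.pos_of_ne_zero this.2.1

lemma IsNumericalGenerators.lt_sum (hn : IsNumericalGenerators n) (hs : 2 ≤ s) (i : Fin s) :
    n i < ∑ j, n j := by
  have : Nontrivial (Fin s) := Fin.nontrivial_iff_two_le.mpr hs
  obtain ⟨j, hj⟩ := exists_ne i
  exact Finset.single_lt_sum hj (Finset.mem_univ i) (Finset.mem_univ j) (hn.pos j)
    fun _ _ _ ↦ Nat.zero_le _

lemma sum_mem_closure_range (n : Fin s → ℕ) : ∑ j, n j ∈ AddSubmonoid.closure (Set.range n) :=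
  sum_mem fun j _ ↦ AddSubmonoid.subset_closure ⟨j, rfl⟩

/-- A numerical semigroup with at least two minimal generators has a pseudo-Frobenius number,
namely its Frobenius number. -/
lemma IsNumericalGenerators.numericalPF_nonempty (hn : IsNumericalGenerators n) (hs : 2 ≤ s) :
    (numericalPF (AddSubmonoid.closure (Set.range n))).Nonempty := by
  have hne : {x : ℕ | x ∉ AddSubmonoid.closure (Set.range n)}.Nonempty := by
    -- If `1` were in the semigroup, minimality would make every generator equal to `1`, which two
    -- distinct generators forbid.
    refine ⟨1, fun h1 ↦ ?_⟩
    have hmin (i : Fin s) : n i = 1 := by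
      have hi : n i ∈ minGens (AddSubmonoid.closure (Set.range n)) := by
        rw [hn.2.1]
        exact ⟨i, rfl⟩
      have hpos := hn.pos i
      have hmem : n i - 1 ∈ AddSubmonoid.closure (Set.range n) := by
        simpa using nsmul_mem h1 (n i - 1)
      have := hi.2.2 1 h1 (n i - 1) hmem (by omega)
      omega
    have h01 := hn.1 ((hmin ⟨0, by omega⟩).trans (hmin ⟨1, by omega⟩).symm)
    simp at h01
  obtain ⟨f, hf, hmax⟩ := Set.exists_max_image _ id hn.2.2 hne
  refine ⟨f, hf, fun t _ ht0 ↦ ?_⟩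
  by_contra hft
  have := hmax (f + t) hft
  simp only [id_eq] at this
  omega

/-- The numerical semigroup `⟨s, s + 1, …, 2s - 1⟩`. -/
lemma isNumericalGenerators_interval (hs : 1 ≤ s) :
    IsNumericalGenerators fun i : Fin s ↦ s + (i : ℕ) := by
  have hge : ∀ x ∈ AddSubmonoid.closure (Set.range fun i : Fin s ↦ s + (i : ℕ)),
      x = 0 ∨ s ≤ x := by
    intro x hx
    induction hx using AddSubmonoid.closure_induction with
    | mem x hx =>
      obtain ⟨i, rfl⟩ := hx
      exact .inr (Nat.le_add_right _ _)
    | zero => exact .inl rfl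
    | add x y _ _ hx hy => omega
  refine ⟨fun i j h ↦ Fin.ext (by simpa using h), (minGens_closure_subset _).antisymm ?_, ?_⟩
  · rintro _ ⟨i, rfl⟩
    refine ⟨AddSubmonoid.subset_closure ⟨i, rfl⟩, by simp; omega, fun b hb c hc h ↦ ?_⟩
    have := hge b hb
    have := hge c hc
    have := i.2
    simp only at h
    omega
  · refine (Set.finite_Iio s).subset fun x hx ↦ ?_
    by_contra hxs
    refine hx ?_
    simp only [Set.mem_Iio, not_lt] at hxs
    clear hx
    induction x using Nat.strong_induction_on with
    | _ x ih =>
      by_cases h2 : x < 2 * s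
      · exact AddSubmonoid.subset_closure ⟨⟨x - s, by omega⟩, by simp; omega⟩
      · have h₁ := ih (x - s) (by omega) (by omega)
        have h₂ := ih s (by omega) le_rfl
        have := add_mem h₁ h₂
        rwa [Nat.sub_add_cancel hxs] at this

end Numerical

/-! ### The three classes and unboundedness -/

section Classes

variable {a p : ℕ}

/-- The class of embedding dimension five. -/
theorem glued_one_properties {m : ℕ} (ha : 3 ≤ a) (hodd : Odd a) (hp : 1 ≤ p) (hm : 2 ≤ m)
    (h : 2 ≤ p ∨ Nat.Coprime a m) :
    IsSapGluing a p m ![1] ∧ embDim (glued a p m ![1]) = 5 ∧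
      (∀ (k : Type u) [Field k], IsMPD k (glued a p m ![1])) ∧
      (PF (glued a p m ![1])).Finite ∧ a ^ p - 1 ≤ bettiType (glued a p m ![1]) := by
  have hn := minGens_closure_range_one
  have htop (x : ℕ) : x ∈ AddSubmonoid.closure (Set.range (![1] : Fin 1 → ℕ)) := by
    simp
  have hlt (i : Fin 1) : (![1] : Fin 1 → ℕ) i < m := by
    rw [Matrix.cons_val_fin_one]
    omega
  have hm1 : 1 ≤ m := by omega
  have hbetti : a ^ p - 1 ≤ bettiType (glued a p m ![1]) := by
    -- For `ℕ` the only admissible `H` has `H - m = -1`, the pseudo-Frobenius number of `ℕ` in `ℤ`.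
    have := mul_le_bettiType_glued ha hodd hp h hm1 (htop m) (A := {m - 1}) (by
      rintro H rfl
      refine ⟨htop _, fun t _ ↦ by omega, fun t _ ht ↦ ⟨t - 1, htop _, by omega⟩⟩)
    simpa using this
  have hq := three_le_pow ha hp
  exact ⟨isSapGluing ha hodd hp h one_ne_zero hn hm1 (htop m) hlt,
    embDim_glued ha hodd hp h (Function.injective_of_subsingleton _) hn hm1 hlt,
    fun k _ ↦ isMPD_glued k ha hodd hp h hn hm1 hlt (by omega), finite_PF_glued ha hm1, hbetti⟩

/-- The classes of embedding dimension at least six. -/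
theorem glued_sum_properties {s : ℕ} {n : Fin s → ℕ} (ha : 3 ≤ a) (hodd : Odd a) (hp : 1 ≤ p)
    (hs : 2 ≤ s) (hn : IsNumericalGenerators n) (h : 2 ≤ p ∨ Nat.Coprime a (∑ i, n i)) :
    IsSapGluing a p (∑ i, n i) n ∧ embDim (glued a p (∑ i, n i) n) = s + 4 ∧
      (∀ (k : Type u) [Field k], IsMPD k (glued a p (∑ i, n i) n)) ∧
      (PF (glued a p (∑ i, n i) n)).Finite ∧
      (numericalPF (AddSubmonoid.closure (Set.range n))).ncard * (a ^ p - 1) ≤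
        bettiType (glued a p (∑ i, n i) n) := by
  have hmT := sum_mem_closure_range n
  have hlt := hn.lt_sum hs
  have hm : 1 ≤ ∑ i, n i := (Nat.zero_le _).trans_lt (hlt ⟨0, by omega⟩)
  generalize ∑ i, n i = m at *
  have hbetti : (numericalPF (AddSubmonoid.closure (Set.range n))).ncard * (a ^ p - 1) ≤
      bettiType (glued a p m n) := by
    rw [← Set.ncard_image_of_injective _ (add_right_injective m)]
    refine mul_le_bettiType_glued ha hodd hp h hm hmT ?_
    rintro _ ⟨f, ⟨hf, hf'⟩, rfl⟩
    refine ⟨(congrArg (· ∈ _) (add_comm f m)).mp (hf' m hmT (by omega)), fun t ht heq ↦ hf ?_,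
      fun t ht ht0 ↦ ⟨f + t, hf' t ht ht0, add_assoc m f t⟩⟩
    rwa [add_left_cancel heq]
  have hfin : (numericalPF (AddSubmonoid.closure (Set.range n))).Finite :=
    hn.2.2.subset fun f hf ↦ hf.1
  have hpos : 0 < bettiType (glued a p m n) := by
    have := three_le_pow ha hp
    exact (Nat.mul_pos ((Set.ncard_pos hfin).mpr (hn.numericalPF_nonempty hs)) (by omega)).trans_le
      hbetti
  exact ⟨isSapGluing ha hodd hp h (by omega) hn.2.1 hm hmT hlt,
    embDim_glued ha hodd hp h hn.1 hn.2.1 hm hlt,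
    fun k _ ↦ isMPD_glued k ha hodd hp h hn.2.1 hm hlt hpos, finite_PF_glued ha hm, hbetti⟩

/-- MPD-semigroups in `ℕ²` of any embedding dimension `e ≥ 4` have unbounded Betti-type. -/
theorem exists_isMPD_le_bettiType {e : ℕ} (he : 4 ≤ e) (N : ℕ) :
    ∃ S : AddSubmonoid (Fin 2 → ℕ), embDim S = e ∧ (∀ (k : Type u) [Field k], IsMPD k S) ∧
      (PF S).Finite ∧ N ≤ bettiType S := by
  -- With `p = 2` the arithmetic condition on the gluing holds for every multiplier, so only `a` has
  -- to grow.
  obtain ⟨a, ha, hodd, hN⟩ : ∃ a, 3 ≤ a ∧ Odd a ∧ N ≤ a ^ 2 - 1 := by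
    refine ⟨2 * N + 3, by omega, ⟨N + 1, by ring⟩, ?_⟩
    have := Nat.le_self_pow two_ne_zero (2 * N + 3)
    omega
  obtain rfl | rfl | h6 : e = 4 ∨ e = 5 ∨ 6 ≤ e := by omega
  · exact ⟨sap a 2, embDim_sap ha one_le_two, fun k _ ↦ isMPD_sap k ha hodd one_le_two,
      finite_PF_sap ha, hN.trans (le_bettiType_sap ha hodd one_le_two)⟩
  · obtain ⟨-, h₁, h₂, h₃, h₄⟩ := glued_one_properties ha hodd one_le_two (le_refl 2) (.inl le_rfl)
    exact ⟨_, h₁, h₂, h₃, hN.trans h₄⟩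
  · obtain ⟨s, rfl⟩ : ∃ s, e = s + 4 := ⟨e - 4, by omega⟩
    have hs : 2 ≤ s := by omega
    have hn := isNumericalGenerators_interval (by omega : 1 ≤ s)
    obtain ⟨-, h₁, h₂, h₃, h₄⟩ := glued_sum_properties ha hodd one_le_two hs hn (.inl le_rfl)
    have hfin := hn.2.2.subset fun f
      (hf : f ∈ numericalPF (AddSubmonoid.closure (Set.range fun i : Fin s ↦ s + (i : ℕ)))) ↦ hf.1
    have hpos := (Set.ncard_pos hfin).mpr (hn.numericalPF_nonempty hs)
    exact ⟨_, h₁, h₂, h₃, hN.trans ((Nat.le_mul_of_pos_left _ hpos).trans h₄)⟩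

end Classes

end AffineSemigroup

open AffineSemigroup in
theorem mainTheorem5 :
    -- for every `e ≥ 4`, the Betti-type of MPD-semigroups in `ℕ²` of embedding dimension `e`
    -- is unbounded
    (∀ e : ℕ, 4 ≤ e → ∀ N : ℕ, ∃ S : AddSubmonoid (Fin 2 → ℕ),
      embDim S = e ∧ (∀ (k : Type u) [Field k], IsMPD k S) ∧
      (PF S).Finite ∧ N ≤ bettiType S) ∧
    -- the class for `e = 4`
    (∀ a p : ℕ, 3 ≤ a → Odd a → 1 ≤ p →
      embDim (sap a p) = 4 ∧ (∀ (k : Type u) [Field k], IsMPD k (sap a p)) ∧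
      (PF (sap a p)).Finite ∧ a ^ p - 1 ≤ bettiType (sap a p)) ∧
    -- the class for `e = 5`: gluing with a multiple of the numerical semigroup `ℕ = ⟨1⟩`
    (∀ a p m : ℕ, 3 ≤ a → Odd a → 1 ≤ p → 2 ≤ m → (2 ≤ p ∨ Nat.Coprime a m) →
      IsSapGluing a p m ![1] ∧ embDim (glued a p m ![1]) = 5 ∧
      (∀ (k : Type u) [Field k], IsMPD k (glued a p m ![1])) ∧
      (PF (glued a p m ![1])).Finite ∧ a ^ p - 1 ≤ bettiType (glued a p m ![1])) ∧
    -- the class for `e = s + 4 ≥ 6`: gluing with a numerical semigroup with `s` generators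
    (∀ a p : ℕ, 3 ≤ a → Odd a → 1 ≤ p →
      ∀ (s : ℕ) (n : Fin s → ℕ), 2 ≤ s → IsNumericalGenerators n →
      (2 ≤ p ∨ Nat.Coprime a (∑ i, n i)) →
      IsSapGluing a p (∑ i, n i) n ∧ embDim (glued a p (∑ i, n i) n) = s + 4 ∧
      (∀ (k : Type u) [Field k], IsMPD k (glued a p (∑ i, n i) n)) ∧
      (PF (glued a p (∑ i, n i) n)).Finite ∧
      (numericalPF (AddSubmonoid.closure (Set.range n))).ncard * (a ^ p - 1) ≤
        bettiType (glued a p (∑ i, n i) n)) := by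
  exact ⟨fun e he N ↦ exists_isMPD_le_bettiType he N,
    fun a p ha hodd hp ↦ ⟨embDim_sap ha hp, fun k _ ↦ isMPD_sap k ha hodd hp, finite_PF_sap ha,
      le_bettiType_sap ha hodd hp⟩,
    fun a p m ha hodd hp hm h ↦ glued_one_properties ha hodd hp hm h,
    fun a p ha hodd hp s n hs hn h ↦ glued_sum_properties ha hodd hp hs hn h⟩
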